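/- Let $\mathcal R=(R,<,+,0,\ldots)$ be a first-order structure expanding a nontrivial densely linearly ordered abelian group. "Definable" means definable with parameters, $R$ carries the order topology and $R^n$ the product topology. An open interval is a set $(c,d)$, and a closed interval a set $[c,d]$, with $c,d\in R$; an open box in $R^m$ is a product of $m$ open intervals. For $X\subseteq R^{m+1}$ and $x\in R^m$ put $X_x=\{y\in R : (x,y)\in X\}$. Assume that $\mathcal R$ is definably complete, i.e. every nonempty definable subset of $R$ that is bounded above has a least upper bound in $R$. The *open core* of $\mathcal R$ is the structure on $R$ with one $n$-ary relation for every $n$ and every open subset of $R^n$ definable in $\mathcal R$. *Local uniform finiteness.* - $\mathcal R\models\mathrm{LUF}_2$ if for every $m\ge 0$, every definable $X\subseteq R^{m+1}$, $a\in R$ and $b\in R^m$ there are a positive integer $N$, a closed interval $I$ with $a\in\operatorname{int}(I)$ and an open box $U\subseteq R^m$ with $b\in U$ such that for all $x\in U$ and all closed intervals $J$ with $a\in\operatorname{int}(J)\subseteq I$, the set $X_x\cap J$ is infinite or has at most $N$ elements. - $\mathcal R\models\mathrm{LUF}_1$ if moreover one can always take $U=R^m$. - $\mathcal R\models\mathrm{SLUF}$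 if moreover $I$ can be chosen independently of $X$: for every $m\ge 0$ and $a\in R$ there is a closed interval $I$ with $a\in\operatorname{int}(I)$ such that for every definable $X\subseteq R^{m+1}$ there is a positive integer $N$ such that for all $x\in R^m$ and all closed intervals $J$ with $a\in\operatorname{int}(J)\subseteq I$, the set $X_x\cap J$ is infinite or has at most $N$ elements. *Local o-minimality.* A structure $\mathcal M$ on $R$ expanding $(R,<)$ is - *strongly locally o-minimal* if for every $a\in R$ there is an open interval $I\ni a$ such that $X\cap I$ is a finite union of points and open intervals for every $X\subseteq R$ definable in $\mathcal M$; - *uniformly locally o-minimal of the first kind* if for every $m\ge 0$, every $X\subseteq R^{m+1}$ definable in $\mathcal M$ and every $a\in R$ there is an open interval $I\ni a$ such that $X_x\cap I$ is a finite union of points and open intervals for all $x\in R^m$; - *uniformly locally o-minimal of the second kind* if for every $m\ge 0$, every $X\subseteq R^{m+1}$ definable in $\mathcal M$, every $a\in R$ and $b\in R^m$ there are an open interval $I\ni a$ and an open box $B\ni b$ in $R^m$ such that $X_x\cap I$ is a finite union of points and open intervals for all $x\in B$. Then: 1. If $\mathcal R\models\mathrm{SLUF}$, the open core of $\mathcal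 R$ is strongly locally o-minimal. 2. If $\mathcal R\models\mathrm{LUF}_1$, the open core of $\mathcal R$ is uniformly locally o-minimal of the first kind. 3. If $\mathcal R\models\mathrm{LUF}_2$, the open core of $\mathcal R$ is uniformly locally o-minimal of the second kind. -/

import Mathlib

namespace LocOMin

open Set

universe u v w

/-- Function symbols of the language of ordered abelian groups: `0` and `+`. -/
inductive OAGFunctions : ℕ → Type
  | zero : OAGFunctions 0
  | add : OAGFunctions 2

/-- Relation symbols of the language of ordered abelian groups: `<`. -/
inductive OAGRelations : ℕ → Type
  | lt : OAGRelations 2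

/-- The language `{<, +, 0}` of ordered abelian groups. -/
def oagLanguage : FirstOrder.Language.{0, 0} := ⟨OAGFunctions, OAGRelations⟩

/-- The standard interpretation of `<`, `+`, `0`. An expansion of the ordered abelian group `R` is
an `L`-structure on `R` with a map `φ : oagLanguage →ᴸ L` such that `φ.IsExpansionOn R`. -/
instance oagStructure (R : Type w) [AddCommGroup R] [LinearOrder R] :
    oagLanguage.Structure R where
  funMap := fun {_} f x =>
    match f, x with
    | OAGFunctions.zero, _ => 0
    | OAGFunctions.add, x => x 0 + x 1
  RelMap := fun {_} r x =>
    match r, x with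
    | OAGRelations.lt, x => x 0 < x 1

/-- The fiber `X_x = {y | (x, y) ∈ X}` of `X ⊆ R^(m+1)` over `x ∈ R^m`. -/
def fiber {R : Type w} {m : ℕ} (X : Set (Fin (m + 1) → R)) (x : Fin m → R) : Set R :=
  {y | (Fin.snoc x y : Fin (m + 1) → R) ∈ X}

/-- The open box `∏ (p i, q i)` in `R^m`. -/
def openBox {R : Type w} [LinearOrder R] {m : ℕ} (p q : Fin m → R) : Set (Fin m → R) :=
  Set.univ.pi fun i => Ioo (p i) (q i)

/-- `S` is a finite union of points and open intervals with endpoints in `R`. -/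
def IsFiniteUnionPointsIntervals {R : Type w} [LinearOrder R] (S : Set R) : Prop :=
  ∃ (F : Set R) (P : Set (R × R)), F.Finite ∧ P.Finite ∧ S = F ∪ ⋃ p ∈ P, Ioo p.1 p.2

/-- The bound in the definitions of local uniform finiteness: for all closed intervals `J` with
`a ∈ int J ⊆ I`, the set `S ∩ J` is infinite or has at most `N` elements. -/
def FinitenessBound {R : Type w} [LinearOrder R] [TopologicalSpace R] (S I : Set R) (a : R)
    (N : ℕ) : Prop :=
  ∀ e f : R, a ∈ interior (Icc e f) → interior (Icc e f) ⊆ I →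
    (S ∩ Icc e f).Infinite ∨ (S ∩ Icc e f).ncard ≤ N

section Properties

variable (L : FirstOrder.Language.{u, v}) (R : Type w) [L.Structure R]

/-- Definability of subsets of `R^n` in the structure, with arbitrary parameters from `R`. -/
def Def {n : ℕ} (X : Set (Fin n → R)) : Prop :=
  (Set.univ : Set R).Definable L X

/-- Definable completeness: every nonempty definable subset of `R` which is bounded above has a
least upper bound in `R`. -/
def DC [LinearOrder R] : Prop :=
  ∀ X : Set R, (Set.univ : Set R).Definable₁ L X → X.Nonempty → BddAbove X → ∃ s, IsLUB X s

/-- Locally uniform finiteness of the second kind. -/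
def LUF₂ [LinearOrder R] [TopologicalSpace R] : Prop :=
  ∀ (m : ℕ) (X : Set (Fin (m + 1) → R)), Def L R X → ∀ (a : R) (b : Fin m → R),
    ∃ N : ℕ, 0 < N ∧ ∃ c d : R, a ∈ interior (Icc c d) ∧
      ∃ p q : Fin m → R, b ∈ openBox p q ∧
        ∀ x ∈ openBox p q, FinitenessBound (fiber X x) (Icc c d) a N

/-- Locally uniform finiteness of the first kind: the box of the second kind is all of `R^m`. -/
def LUF₁ [LinearOrder R] [TopologicalSpace R] : Prop :=
  ∀ (m : ℕ) (X : Set (Fin (m + 1) → R)), Def L R X → ∀ a : R,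
    ∃ N : ℕ, 0 < N ∧ ∃ c d : R, a ∈ interior (Icc c d) ∧
      ∀ x : Fin m → R, FinitenessBound (fiber X x) (Icc c d) a N

/-- Strongly locally uniform finiteness: as in the first kind, with an interval that does not
depend on the definable set `X ⊆ R^(m+1)`. -/
def SLUF [LinearOrder R] [TopologicalSpace R] : Prop :=
  ∀ (m : ℕ) (a : R), ∃ c d : R, a ∈ interior (Icc c d) ∧
    ∀ X : Set (Fin (m + 1) → R), Def L R X →
      ∃ N : ℕ, 0 < N ∧ ∀ x : Fin m → R, FinitenessBound (fiber X x) (Icc c d) a N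

/-- Strong local o-minimality. -/
def StronglyLocallyOMinimal [LinearOrder R] : Prop :=
  ∀ a : R, ∃ c d : R, a ∈ Ioo c d ∧
    ∀ X : Set R, (Set.univ : Set R).Definable₁ L X → IsFiniteUnionPointsIntervals (X ∩ Ioo c d)

/-- Uniform local o-minimality of the first kind. The case `m = 0` is local o-minimality. -/
def UniformlyLocallyOMinimal₁ [LinearOrder R] : Prop :=
  ∀ (m : ℕ) (X : Set (Fin (m + 1) → R)), Def L R X → ∀ a : R,
    ∃ c d : R, a ∈ Ioo c d ∧
      ∀ x : Fin m → R, IsFiniteUnionPointsIntervals (fiber X x ∩ Ioo c d)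

/-- Uniform local o-minimality of the second kind. The case `m = 0` is local o-minimality. -/
def UniformlyLocallyOMinimal₂ [LinearOrder R] : Prop :=
  ∀ (m : ℕ) (X : Set (Fin (m + 1) → R)), Def L R X → ∀ (a : R) (b : Fin m → R),
    ∃ c d : R, a ∈ Ioo c d ∧ ∃ p q : Fin m → R, b ∈ openBox p q ∧
      ∀ x ∈ openBox p q, IsFiniteUnionPointsIntervals (fiber X x ∩ Ioo c d)

/-- The language of the open core: one `n`-ary relation symbol for every open subset of `R^n`
definable (with parameters) in the `L`-structure `R`. -/
def openCore [TopologicalSpace R] : FirstOrder.Language.{0, w} :=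
  ⟨fun _ => Empty, fun n => {U : Set (Fin n → R) // IsOpen U ∧ Def L R U}⟩

/-- The open core of `R`: each symbol of `openCore L R` is interpreted by its open set. -/
instance openCoreStructure [TopologicalSpace R] : (openCore L R).Structure R where
  funMap := fun {_} f _ => f.elim
  RelMap := fun {_} U x => x ∈ U.1

end Properties

end LocOMin

/-! Call a set `DSig` if it is the union of a definable family of closed bounded sets `F r s`,
increasing in `r` and growing as `s` tends to `0`: a definable substitute for σ-compactness. The
core of the proof is that this class is closed under Boolean operations and coordinate projections.
It contains the definable open sets, so induction on formulas puts every set definable in the open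
core into it (`DSig.of_definable_openCore`).

Local uniform finiteness enters through `thin_iUnion_chain`: a definable chain of closed discrete
subsets of the line has a closed discrete union. Applied to the left endpoints of complementary
gaps, this shows that a closed definable set without interior is closed and discrete
(`thin_of_isClosed`). Induction on the dimension then gives a strong Baire property (`baire`): if
all members `F r s` have empty interior, their union is nowhere dense.

Projections are handled by definable compactness, a consequence of definable completeness.
Complements are the hard case. Inside `closedLocus A` the set `A` is relatively closed, so its
complement there is open; what remains of `A` outside has smaller dimension
(`DimLT.sdiff_closedLocus`), and one recurses.

Finally, the Baire property makes frontiers of fibers of a `DSig` set closed and discrete. These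
frontiers form a family definable in the original structure, so the finiteness hypothesis applies to
it, and a closed discrete set obeying the bound is finite on the interval
(`Thin.finite_of_finitenessBound`). Between neighbouring frontier points membership is constant. The
three conclusions differ only in how uniform the interval is, which is inherited from the
hypothesis. -/

namespace LocOMin

open Set FirstOrder Filter Topology

universe u v w

set_option linter.unusedSectionVars false

/-! ### A calculus of definable predicates and maps, automated by `fun_prop` -/

/-- Types identified with a finite power of `R`. -/
class Ctx (R : Type w) (Γ : Type w) where
  idx : Type
  [finite_idx : Finite idx]
  coords : Γ ≃ (idx → R)

attribute [instance] Ctx.finite_idx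

instance Ctx.self (R : Type w) : Ctx R R where
  idx := Unit
  coords := (Equiv.funUnique Unit R).symm

instance Ctx.pi (R : Type w) (ι : Type) [Finite ι] : Ctx R (ι → R) where
  idx := ι
  coords := Equiv.refl _

instance Ctx.prod (R Γ Δ : Type w) [Ctx R Γ] [Ctx R Δ] : Ctx R (Γ × Δ) where
  idx := Ctx.idx R Γ ⊕ Ctx.idx R Δ
  coords :=
    { toFun := fun p => Sum.elim (Ctx.coords p.1) (Ctx.coords p.2)
      invFun := fun v => (Ctx.coords.symm (v ∘ Sum.inl), Ctx.coords.symm (v ∘ Sum.inr))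
      left_inv := fun p => by simp
      right_inv := fun v => by simp }

section

variable {L : FirstOrder.Language.{u, v}} {R : Type w} [L.Structure R] {Γ Δ Θ : Type w}
  [Ctx R Γ] [Ctx R Δ] [Ctx R Θ]

variable (L R) in
/-- Definability with parameters of a predicate. -/
@[fun_prop]
def Dfn (P : Γ → Prop) : Prop :=
  (univ : Set R).Definable L {v : Ctx.idx R Γ → R | P (Ctx.coords.symm v)}

variable (L R) in
/-- Definability with parameters of a map, by its graph. -/
@[fun_prop]
def DMap (f : Γ → Δ) : Prop := Dfn L R fun p : Γ × Δ => p.2 = f p.1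

theorem Dfn.and {P Q : Γ → Prop} (hP : Dfn L R P) (hQ : Dfn L R Q) :
    Dfn L R fun x => P x ∧ Q x := Definable.inter hP hQ

theorem Dfn.or {P Q : Γ → Prop} (hP : Dfn L R P) (hQ : Dfn L R Q) :
    Dfn L R fun x => P x ∨ Q x := Definable.union hP hQ

theorem Dfn.not {P : Γ → Prop} (hP : Dfn L R P) : Dfn L R fun x => ¬ P x := Definable.compl hP

theorem Dfn.imp {P Q : Γ → Prop} (hP : Dfn L R P) (hQ : Dfn L R Q) :
    Dfn L R fun x => P x → Q x := by
  simpa only [imp_iff_not_or] using hP.not.or hQ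

theorem Dfn.const (p : Prop) : Dfn L R fun _ : Γ => p := by
  by_cases h : p
  · simp [Dfn, h, definable_univ]
  · simp [Dfn, h, definable_empty]

/-- Maps that only permute, repeat or drop coordinates need no quantifier. This base case is what
allows `Dfn.comp_map` to treat an arbitrary definable map by quantifying over its value. -/
theorem Dfn.coord_comp {P : Δ → Prop} (hP : Dfn L R P) (g : Γ → Δ)
    (e : Ctx.idx R Δ → Ctx.idx R Γ) (he : ∀ x, Ctx.coords (g x) = Ctx.coords x ∘ e) :
    Dfn L R fun x => P (g x) := by
  have h := Definable.preimage_comp e hP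
  unfold Dfn
  convert h using 1
  ext v
  have := he (Ctx.coords.symm v)
  rw [Equiv.apply_symm_apply, ← Equiv.eq_symm_apply] at this
  simp [this]

theorem Dfn.ex {P : Γ → Δ → Prop} (h : Dfn L R fun p : Γ × Δ => P p.1 p.2) :
    Dfn L R fun x => ∃ y, P x y := by
  have := Definable.image_comp h (Sum.inl : Ctx.idx R Γ → Ctx.idx R Γ ⊕ Ctx.idx R Δ)
  unfold Dfn
  convert this using 1
  ext v
  simp only [mem_ofPred_eq, mem_image]
  constructor
  · rintro ⟨y, hy⟩
    refine ⟨Sum.elim v (Ctx.coords y), ?_, by ext; simp⟩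
    convert hy <;> simp [Ctx.coords]
  · rintro ⟨w, hw, rfl⟩
    exact ⟨_, hw⟩

theorem Dfn.all {P : Γ → Δ → Prop} (h : Dfn L R fun p : Γ × Δ => P p.1 p.2) :
    Dfn L R fun x => ∀ y, P x y := by
  have := (Dfn.ex (P := fun x y => ¬ P x y) h.not).not
  simpa only [not_exists, not_not] using this

theorem Dfn.all_finite {κ : Type*} [Finite κ] {P : Γ → κ → Prop} (h : ∀ k, Dfn L R fun x => P x k) :
    Dfn L R fun x => ∀ k, P x k := by
  have := Set.definable_iInter_of_finite h
  unfold Dfn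
  convert this using 1
  ext v
  simp

theorem Dfn.eq_coord : Dfn L R fun p : Γ × Γ => p.2 = p.1 := by
  have : Dfn L R fun p : Γ × Γ => ∀ i : Ctx.idx R Γ, Ctx.coords p.2 i = Ctx.coords p.1 i := by
    refine Dfn.all_finite fun i => ?_
    refine ⟨((FirstOrder.Language.var (Sum.inr i)).equal (FirstOrder.Language.var (Sum.inl i)) :
      L[[(univ : Set R)]].Formula (Ctx.idx R Γ ⊕ Ctx.idx R Γ)), ?_⟩
    ext v
    simp [Ctx.coords]
  simpa only [← funext_iff, EmbeddingLike.apply_eq_iff_eq] using this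

theorem coords_fst (p : Γ × Δ) : Ctx.coords (R := R) p.1 = Ctx.coords p ∘ Sum.inl := by
  rfl

theorem coords_snd (p : Γ × Δ) : Ctx.coords (R := R) p.2 = Ctx.coords p ∘ Sum.inr := by
  rfl

theorem DMap.of_coords (g : Γ → Δ) (e : Ctx.idx R Δ → Ctx.idx R Γ)
    (he : ∀ x, Ctx.coords (g x) = Ctx.coords x ∘ e) : DMap L R g := by
  refine (Dfn.eq_coord (L := L) (R := R) (Γ := Δ)).coord_comp
    (fun p : Γ × Δ => (g p.1, p.2)) (Sum.map e id) fun p => ?_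
  ext (i | i)
  · exact congrFun (he p.1) i
  · rfl

@[fun_prop]
theorem DMap.id : DMap L R fun x : Γ => x := Dfn.eq_coord

@[fun_prop]
theorem Dfn.comp_map {P : Δ → Prop} {f : Γ → Δ} (hP : Dfn L R P) (hf : DMap L R f) :
    Dfn L R fun x => P (f x) := by
  have : Dfn L R fun x => ∃ y, y = f x ∧ P y :=
    Dfn.ex (Dfn.and hf (hP.coord_comp Prod.snd Sum.inr coords_snd))
  simpa using this

theorem DMap.fst' : DMap L R (Prod.fst : Γ × Δ → Γ) := DMap.of_coords _ Sum.inl coords_fst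

theorem DMap.snd' : DMap L R (Prod.snd : Γ × Δ → Δ) := DMap.of_coords _ Sum.inr coords_snd

@[fun_prop]
theorem DMap.comp {g : Δ → Θ} {f : Γ → Δ} (hg : DMap L R g) (hf : DMap L R f) :
    DMap L R fun x => g (f x) := by
  have h1 : Dfn L R fun p : (Γ × Θ) × Δ => p.2 = f p.1.1 :=
    Dfn.coord_comp hf (fun p : (Γ × Θ) × Δ => (p.1.1, p.2))
      (Sum.elim (Sum.inl ∘ Sum.inl) Sum.inr) fun p => by ext (i | i) <;> rfl
  have h2 : Dfn L R fun p : (Γ × Θ) × Δ => p.1.2 = g p.2 :=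
    Dfn.coord_comp hg (fun p : (Γ × Θ) × Δ => (p.2, p.1.2))
      (Sum.elim Sum.inr (Sum.inl ∘ Sum.inr)) fun p => by ext (i | i) <;> rfl
  have : Dfn L R fun p : Γ × Θ => ∃ y, y = f p.1 ∧ p.2 = g y := Dfn.ex (h1.and h2)
  simpa [DMap] using this

@[fun_prop]
theorem DMap.fst {f : Γ → Δ × Θ} (hf : DMap L R f) : DMap L R fun x => (f x).1 :=
  DMap.fst'.comp hf

@[fun_prop]
theorem DMap.snd {f : Γ → Δ × Θ} (hf : DMap L R f) : DMap L R fun x => (f x).2 :=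
  DMap.snd'.comp hf

@[fun_prop]
theorem DMap.prodMk {f : Γ → Δ} {g : Γ → Θ} (hf : DMap L R f) (hg : DMap L R g) :
    DMap L R fun x => (f x, g x) := by
  have h1 : Dfn L R fun p : Γ × (Δ × Θ) => p.2.1 = f p.1 :=
    Dfn.coord_comp hf (fun p : Γ × (Δ × Θ) => (p.1, p.2.1))
      (Sum.elim Sum.inl (Sum.inr ∘ Sum.inl)) fun p => by ext (i | i) <;> rfl
  have h2 : Dfn L R fun p : Γ × (Δ × Θ) => p.2.2 = g p.1 :=
    Dfn.coord_comp hg (fun p : Γ × (Δ × Θ) => (p.1, p.2.2))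
      (Sum.elim Sum.inl (Sum.inr ∘ Sum.inr)) fun p => by ext (i | i) <;> rfl
  simpa only [DMap, Prod.ext_iff] using h1.and h2

@[fun_prop]
theorem DMap.apply' {ι : Type} [Finite ι] (i : ι) : DMap L R fun x : ι → R => x i :=
  DMap.of_coords _ (fun _ => i) fun _ => rfl

@[fun_prop]
theorem DMap.pi {ι : Type} [Finite ι] {f : Γ → ι → R} (hf : ∀ i, DMap L R fun x => f x i) :
    DMap L R f := by
  have : Dfn L R fun p : Γ × (ι → R) => ∀ i, p.2 i = f p.1 i := by
    refine Dfn.all_finite fun i => ?_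
    exact Dfn.comp_map (f := fun p : Γ × (ι → R) => (p.1, p.2 i)) (hf i) (by fun_prop)
  simpa only [DMap, funext_iff] using this

@[fun_prop]
theorem DMap.const (d : Δ) : DMap L R fun _ : Γ => d := by
  have h1 (i : Ctx.idx R Δ) : Dfn L R fun p : Γ × Δ => Ctx.coords p.2 i = Ctx.coords d i := by
    refine ⟨((FirstOrder.Language.var (Sum.inr i)).equal
      (L.con (⟨Ctx.coords d i, trivial⟩ : (univ : Set R))).term :
      L[[(univ : Set R)]].Formula (Ctx.idx R Γ ⊕ Ctx.idx R Δ)), ?_⟩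
    ext v
    simp [Ctx.coords]
  simpa only [DMap, ← funext_iff, EmbeddingLike.apply_eq_iff_eq] using Dfn.all_finite h1

theorem Dfn.eq {f g : Γ → Δ} (hf : DMap L R f) (hg : DMap L R g) : Dfn L R fun x => f x = g x :=
  Dfn.comp_map (f := fun x => (g x, f x)) Dfn.eq_coord (by fun_prop)

attribute [fun_prop] Dfn.and Dfn.or Dfn.not Dfn.const Dfn.ex Dfn.eq Dfn.all Dfn.imp Dfn.all_finite

theorem Dfn.congr {P Q : Γ → Prop} (hP : Dfn L R P) (h : ∀ x, Q x ↔ P x) : Dfn L R Q := by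
  rwa [show Q = P from funext fun x => propext (h x)]

/-- The ordered group operations are definable. -/
class DefinableOAG (L : FirstOrder.Language.{u, v}) (R : Type w) [L.Structure R] [AddCommGroup R]
    [LinearOrder R] : Prop where
  lt : Dfn L R fun p : R × R => p.1 < p.2
  add : DMap L R fun p : R × R => p.1 + p.2

variable [AddCommGroup R] [LinearOrder R]

theorem DefinableOAG.of_expansion (φ : oagLanguage.LHom L) [φ.IsExpansionOn R] :
    DefinableOAG L R := by
  constructor
  · have : (∅ : Set R).Definable oagLanguage {v : Unit ⊕ Unit → R | v (.inl ()) < v (.inr ())} := by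
      rw [empty_definable_iff]
      refine ⟨FirstOrder.Language.Relations.formula₂ (L := oagLanguage) OAGRelations.lt
        (FirstOrder.Language.var (.inl ())) (FirstOrder.Language.var (.inr ())), ?_⟩
      ext v
      simp
      rfl
    have := (this.map_expansion φ).mono (empty_subset univ)
    convert! this using 1
  · have : (∅ : Set R).Definable oagLanguage {v : (Unit ⊕ Unit) ⊕ Unit → R |
        v (.inr ()) = v (.inl (.inl ())) + v (.inl (.inr ()))} := by
      rw [empty_definable_iff]
      refine ⟨(FirstOrder.Language.var (.inr ())).equal (FirstOrder.Language.Functions.apply₂ (L := oagLanguage)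
        OAGFunctions.add (FirstOrder.Language.var (.inl (.inl ()))) (FirstOrder.Language.var (.inl (.inr ())))), ?_⟩
      ext v
      simp
      rfl
    have := (this.map_expansion φ).mono (empty_subset univ)
    convert! this using 1

variable [DefinableOAG L R]

@[fun_prop]
theorem DMap.add {f g : Γ → R} (hf : DMap L R f) (hg : DMap L R g) :
    DMap L R fun x => f x + g x :=
  DMap.comp (f := fun x => (f x, g x)) DefinableOAG.add (by fun_prop)

@[fun_prop]
theorem DMap.sub {f g : Γ → R} (hf : DMap L R f) (hg : DMap L R g) :
    DMap L R fun x => f x - g x := by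
  have : Dfn L R fun p : Γ × R => f p.1 = p.2 + g p.1 := by fun_prop
  exact this.congr fun p => by rw [eq_sub_iff_add_eq, eq_comm]

@[fun_prop]
theorem DMap.neg {f : Γ → R} (hf : DMap L R f) : DMap L R fun x => - f x := by
  have : DMap L R fun x => 0 - f x := by fun_prop
  simpa only [zero_sub] using this

@[fun_prop]
theorem Dfn.lt {f g : Γ → R} (hf : DMap L R f) (hg : DMap L R g) : Dfn L R fun x => f x < g x :=
  Dfn.comp_map (f := fun x => (f x, g x)) DefinableOAG.lt (by fun_prop)

@[fun_prop]
theorem Dfn.le {f g : Γ → R} (hf : DMap L R f) (hg : DMap L R g) : Dfn L R fun x => f x ≤ g x := by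
  have : Dfn L R fun x => ¬ g x < f x := by fun_prop
  simpa only [not_lt] using this

@[fun_prop]
theorem DMap.abs [IsOrderedAddMonoid R] {f : Γ → R} (hf : DMap L R f) : DMap L R fun x => |f x| := by
  have : Dfn L R fun p : Γ × R => (0 ≤ f p.1 ∧ p.2 = f p.1) ∨ (f p.1 < 0 ∧ p.2 = - f p.1) := by
    fun_prop
  refine this.congr fun p => ?_
  rcases le_or_gt 0 (f p.1) with h | h
  · simp [abs_of_nonneg h, h, not_lt.2 h]
  · simp [abs_of_neg h, h, not_le.2 h]

end

/-! ### Closed discrete subsets of the line -/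

/-- `S` is closed and discrete. -/
def Thin {R : Type w} [AddCommGroup R] [LinearOrder R] (S : Set R) : Prop :=
  ∀ a, ∃ ε > 0, ∀ y ∈ S, |y - a| < ε → y = a

theorem Thin.mono {R : Type w} [AddCommGroup R] [LinearOrder R] {S T : Set R} (hT : Thin T)
    (h : S ⊆ T) : Thin S := fun a =>
  let ⟨ε, hε, H⟩ := hT a
  ⟨ε, hε, fun y hy => H y (h hy)⟩

section

variable {L : FirstOrder.Language.{u, v}} {R : Type w} [L.Structure R] [AddCommGroup R]
  [LinearOrder R] [IsOrderedAddMonoid R] [DefinableOAG L R]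

theorem dfn_iff_definable₁ {S : Set R} :
    Dfn L R (· ∈ S) ↔ (univ : Set R).Definable₁ L S := by
  constructor
  · intro h
    exact h.comp_map (f := fun v : Fin 1 → R => v 0) (by fun_prop)
  · intro h
    have h' : Dfn L R fun v : Fin 1 → R => v 0 ∈ S := h
    exact h'.comp_map (f := fun (x : R) (_ : Fin 1) => x) (by fun_prop)

theorem DC.exists_isLUB (hDC : DC L R) {S : Set R} (hS : Dfn L R (· ∈ S)) (hne : S.Nonempty)
    (hb : BddAbove S) : ∃ s, IsLUB S s := hDC S (dfn_iff_definable₁.1 hS) hne hb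

theorem DC.exists_isGLB (hDC : DC L R) {S : Set R} (hS : Dfn L R (· ∈ S)) (hne : S.Nonempty)
    (hb : BddBelow S) : ∃ s, IsGLB S s := by
  have h : Dfn L R (· ∈ lowerBounds S) := by
    have : Dfn L R fun x => ∀ y, y ∈ S → x ≤ y := by fun_prop
    exact this
  obtain ⟨s, hs⟩ := hDC.exists_isLUB h hb hne.bddAbove_lowerBounds
  exact ⟨s, isLUB_lowerBounds.1 hs⟩

/-- Definable completeness gives an infimum, and isolation of the points of `S` near it forces it to
be attained. -/
theorem Thin.exists_isLeast (hDC : DC L R) {S : Set R} (hS : Thin S) (hd : Dfn L R (· ∈ S))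
    {x f : R} (hne : (S ∩ Ioc x f).Nonempty) : ∃ y, IsLeast (S ∩ Ioc x f) y := by
  have h : Dfn L R (· ∈ S ∩ Ioc x f) := by
    have : Dfn L R fun y => y ∈ S ∧ x < y ∧ y ≤ f := by fun_prop
    exact this
  obtain ⟨g, hg⟩ := hDC.exists_isGLB h hne ⟨x, fun y hy => hy.2.1.le⟩
  obtain ⟨ε, hε, H⟩ := hS g
  obtain ⟨y, hy, hgy, hy'⟩ := hg.exists_between (lt_add_of_pos_right g hε)
  have : y = g := H y hy.1 (by rw [abs_lt]; constructor
                               · exact (neg_lt_zero.2 hε).trans_le (sub_nonneg.2 hgy)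
                               · rwa [sub_lt_iff_lt_add'])
  exact ⟨g, this ▸ hy, hg.1⟩

/-- Start at `a` and pass repeatedly to the next point of `S`; infinitude guarantees that a next
point remains. -/
theorem Thin.exists_ncard_eq (hDC : DC L R) {S : Set R} (hS : Thin S) (hd : Dfn L R (· ∈ S))
    {a f : R} (haf : a ≤ f) (hinf : (S ∩ Ioc a f).Infinite) (k : ℕ) :
    ∃ y ∈ Icc a f, (S ∩ Ioc a y).Finite ∧ (S ∩ Ioc a y).ncard = k := by
  induction k with
  | zero => exact ⟨a, ⟨le_rfl, haf⟩, by simp, by simp⟩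
  | succ k ih =>
    obtain ⟨y, hy, hfin, hc⟩ := ih
    have hne : (S ∩ Ioc y f).Nonempty := by
      by_contra hne
      rw [not_nonempty_iff_eq_empty] at hne
      refine hinf (hfin.subset fun z hz => ⟨hz.1, hz.2.1, ?_⟩)
      by_contra hzy
      exact hne.subset ⟨hz.1, not_le.1 hzy, hz.2.2⟩
    obtain ⟨y', hy', hl⟩ := hS.exists_isLeast hDC hd hne
    have heq : S ∩ Ioc a y' = insert y' (S ∩ Ioc a y) := by
      ext z
      constructor
      · rintro ⟨hz, haz, hzy⟩
        rcases le_or_gt z y with h | h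
        · exact Or.inr ⟨hz, haz, h⟩
        · exact Or.inl (le_antisymm hzy (hl ⟨hz, h, hzy.trans hy'.2.2⟩))
      · rintro (rfl | ⟨hz, haz, hzy⟩)
        · exact ⟨hy'.1, hy.1.trans_lt hy'.2.1, le_rfl⟩
        · exact ⟨hz, haz, hzy.trans hy'.2.1.le⟩
    refine ⟨y', ⟨hy.1.trans hy'.2.1.le, hy'.2.2⟩, heq ▸ hfin.insert _, ?_⟩
    rw [heq, ncard_insert_of_notMem (fun h => h.2.2.not_gt hy'.2.1) hfin, hc]

variable [DenselyOrdered R] [Nontrivial R] [TopologicalSpace R] [OrderTopology R]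

/-- The bound tolerates infinite intersections, but it holds for every smaller interval around `a`.
If infinitely many points lay to the right, one could cut the interval just after the first `N + 1`
of them, leaving a finite intersection that is too large. -/
theorem Thin.finite_right (hDC : DC L R) {S : Set R} (hS : Thin S) (hd : Dfn L R (· ∈ S))
    {a c d f : R} {N : ℕ} (hca : c < a) (hfd : f ≤ d)
    (hB : ∀ e f, e < a → a < f → c ≤ e → f ≤ d →
      (S ∩ Icc e f).Infinite ∨ (S ∩ Icc e f).ncard ≤ N) : (S ∩ Ioc a f).Finite := by
  by_contra hinf
  have haf : a ≤ f := by
    by_contra h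
    exact hinf (by simp [Ioc_eq_empty fun h' => h h'.le])
  obtain ⟨y, hy, hfin, hc⟩ := hS.exists_ncard_eq hDC hd haf hinf (N + 1)
  have hay : a < y := by
    rcases hy.1.lt_or_eq with h | rfl
    · exact h
    · simp at hc
  obtain ⟨ε, hε, H⟩ := hS a
  -- The left end is so close to `a` that `[e, a]` contains no point of `S` except possibly `a`.
  obtain ⟨e, he, hea⟩ := exists_between (max_lt (sub_lt_self a hε) hca)
  rw [max_lt_iff] at he
  have hsub : S ∩ Icc e y ⊆ insert a (S ∩ Ioc a y) := by
    rintro z ⟨hz, hez, hzy⟩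
    rcases lt_or_ge a z with h | h
    · exact Or.inr ⟨hz, h, hzy⟩
    · refine Or.inl (H z hz ?_)
      rw [abs_sub_lt_iff]
      constructor
      · exact (sub_nonpos.2 h).trans_lt hε
      · exact sub_lt_comm.1 (he.1.trans_le hez)
  have hfin' := (hfin.insert a).subset hsub
  rcases hB e y hea hay he.2.le (hy.2.trans hfd) with h | h
  · exact h hfin'
  · have : (S ∩ Ioc a y).ncard ≤ (S ∩ Icc e y).ncard :=
      ncard_le_ncard (fun z hz => ⟨hz.1, hea.le.trans hz.2.1.le, hz.2.2⟩) hfin'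
    omega

theorem Thin.finite_of_finitenessBound (hDC : DC L R) {S : Set R} (hS : Thin S)
    (hd : Dfn L R (· ∈ S)) {a c d : R} {N : ℕ} (ha : a ∈ Ioo c d)
    (hB : FinitenessBound S (Icc c d) a N) :
    (S ∩ Ioo c d).Finite ∧ (S ∩ Ioo c d).ncard ≤ N := by
  have hB' : ∀ e f, e < a → a < f → c ≤ e → f ≤ d →
      (S ∩ Icc e f).Infinite ∨ (S ∩ Icc e f).ncard ≤ N := fun e f hea haf hce hfd =>
    hB e f (by rw [interior_Icc]; exact ⟨hea, haf⟩)
      (interior_subset.trans (Icc_subset_Icc hce hfd))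
  have hright : (S ∩ Ioc a d).Finite := hS.finite_right hDC hd ha.1 le_rfl hB'
  have hleft : (S ∩ Ico c a).Finite := by
    have hT : Thin (Neg.neg ⁻¹' S) := fun b => by
      obtain ⟨ε, hε, H⟩ := hS (-b)
      refine ⟨ε, hε, fun y hy hyb => neg_injective (H (-y) hy ?_)⟩
      rwa [← neg_sub', abs_neg]
    have hTd : Dfn L R (· ∈ Neg.neg ⁻¹' S) := by
      have : Dfn L R fun x => - x ∈ S := by fun_prop
      exact this
    have key : ∀ e f, Neg.neg '' (S ∩ Icc (-f) (-e)) = (Neg.neg ⁻¹' S) ∩ Icc e f := by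
      intro e f
      rw [image_neg_eq_neg, inter_neg, neg_Icc, neg_neg, neg_neg]
      rfl
    have := hT.finite_right (a := -a) (c := -d) (d := -c) (N := N) hDC hTd (neg_lt_neg ha.2) le_rfl
      fun e f hea haf hce hfd => by
        rw [← key, infinite_image_iff neg_injective.injOn, ncard_image_of_injective _ neg_injective]
        exact hB' (-f) (-e) (neg_lt.1 haf) (lt_neg_of_lt_neg hea) (le_neg_of_le_neg hfd) (neg_le.1 hce)
    refine (this.image Neg.neg).subset fun z hz => ⟨-z, ⟨?_, ?_, ?_⟩, neg_neg z⟩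
    · simpa using hz.1
    · exact neg_lt_neg hz.2.2
    · exact neg_le_neg hz.2.1
  have hfin : (S ∩ Icc c d).Finite := by
    refine ((hleft.union hright).insert a).subset fun z hz => ?_
    rcases lt_trichotomy z a with h | h | h
    · exact Or.inr (Or.inl ⟨hz.1, hz.2.1, h⟩)
    · exact Or.inl h
    · exact Or.inr (Or.inr ⟨hz.1, h, hz.2.2⟩)
  refine ⟨hfin.subset (inter_subset_inter_right _ Ioo_subset_Icc_self), ?_⟩
  rcases hB' c d ha.1 ha.2 le_rfl le_rfl with h | h
  · exact absurd hfin h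
  · exact (ncard_le_ncard (inter_subset_inter_right _ Ioo_subset_Icc_self) hfin).trans h

theorem thin_of_finite {S : Set R} (hS : S.Finite) : Thin S := by
  intro a
  have h : (S \ {a})ᶜ ∈ 𝓝 a := (hS.subset sdiff_subset).isClosed.isOpen_compl.mem_nhds (by simp)
  obtain ⟨ε, hε, H⟩ := (nhds_basis_abs_sub_lt a).mem_iff.1 h
  refine ⟨ε, hε, fun y hy hya => ?_⟩
  by_contra hne
  exact H hya ⟨hy, hne⟩

/-- Turns a definable relation into a set with prescribed fibers, the form in which the finiteness
hypotheses are stated. -/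
theorem Dfn.exists_fiber {m : ℕ} {P : (Fin m → R) → R → Prop}
    (hP : Dfn L R fun p : (Fin m → R) × R => P p.1 p.2) :
    ∃ X : Set (Fin (m + 1) → R), Def L R X ∧ ∀ x, fiber X x = {y | P x y} := by
  have hX : Dfn L R fun v : Fin (m + 1) → R => P (fun i => v i.castSucc) (v (Fin.last m)) :=
    hP.comp_map (f := fun v : Fin (m + 1) → R => (fun i : Fin m => v i.castSucc, v (Fin.last m)))
      (by fun_prop)
  refine ⟨_, hX, fun x => ?_⟩
  ext y
  change P (fun i => (Fin.snoc x y : Fin (m + 1) → R) i.castSucc)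
    ((Fin.snoc x y : Fin (m + 1) → R) (Fin.last m)) ↔ P x y
  simp

/-- The union of a definable chain of closed discrete subsets is closed and discrete. -/
theorem thin_iUnion_chain (hDC : DC L R) (hL : LUF₂ L R) {D : Set R} (hD : Dfn L R (· ∈ D))
    {F : R → Set R} (hF : Dfn L R fun p : R × R => p.2 ∈ F p.1) (hT : ∀ t ∈ D, Thin (F t))
    (hch : ∀ t ∈ D, ∀ t' ∈ D, F t ⊆ F t' ∨ F t' ⊆ F t) : Thin (⋃ t ∈ D, F t) := by
  intro a
  by_contra! hacc
  -- `S x` collects the members of the chain that have no point other than `a` within distance `x`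
  -- of `a`.
  let S : R → Set R := fun x => {y | ∃ t, t ∈ D ∧ y ∈ F t ∧ ∀ z, z ∈ F t → |z - a| < x → z = a}
  have hSd : Dfn L R fun p : R × R => p.2 ∈ S p.1 := by
    have h1 : Dfn L R fun p : (R × R) × R => p.1.2 ∈ F p.2 :=
      hF.comp_map (f := fun p : (R × R) × R => (p.2, p.1.2)) (by fun_prop)
    have h2 : Dfn L R fun p : ((R × R) × R) × R => p.2 ∈ F p.1.2 :=
      hF.comp_map (f := fun p : ((R × R) × R) × R => (p.1.2, p.2)) (by fun_prop)
    have : Dfn L R fun p : ((R × R) × R) => ∀ z, z ∈ F p.2 → |z - a| < p.1.1 → z = a :=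
      Dfn.all (h2.imp (by fun_prop))
    exact Dfn.ex ((by fun_prop : Dfn L R fun p : (R × R) × R => p.2 ∈ D).and (h1.and this))
  -- By accumulation some `F t₀` has a point other than `a` within `x` of `a`. No member
  -- contributing to `S x` can contain `F t₀`, so all of them lie inside it.
  have hST : ∀ x > 0, Thin (S x) := by
    intro x hx
    obtain ⟨y, hy, hya, hne⟩ := hacc x hx
    simp only [mem_iUnion] at hy
    obtain ⟨t₀, ht₀, hy⟩ := hy
    refine (hT t₀ ht₀).mono ?_
    rintro z ⟨t, ht, hz, H⟩
    rcases hch t ht t₀ ht₀ with h | h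
    · exact h hz
    · exact absurd (H y (h hy) hya) hne
  obtain ⟨X, hX, hXS⟩ := Dfn.exists_fiber (m := 1) (P := fun x y => y ∈ S (x 0))
    (hSd.comp_map (f := fun p : (Fin 1 → R) × R => (p.1 0, p.2)) (by fun_prop))
  -- With base point `0`, one bound and one interval serve all small positive `x`. The sets `S x`
  -- exhaust the union as `x` decreases to `0`, so `N + 1` points of the union in the interval would
  -- all lie in a single `S x`.
  obtain ⟨N, -, c, d, ha, p, q, hb, H⟩ := hL 1 X hX a 0
  simp only [hXS] at H
  rw [interior_Icc] at ha
  have hfin : ((⋃ t ∈ D, F t) ∩ Ioo c d).Finite := by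
    by_contra hinf
    obtain ⟨T, hTs, hTc⟩ := Set.Infinite.exists_subset_ncard_eq hinf (N + 1)
    have hTf : T.Finite := finite_of_ncard_ne_zero (by omega)
    have h1 : ∀ᶠ x in 𝓝[>] (0 : R), ∀ y ∈ T, y ∈ S x := by
      rw [eventually_all_finite hTf]
      intro y hy
      have := (hTs hy).1
      simp only [mem_iUnion] at this
      obtain ⟨t, ht, hyt⟩ := this
      obtain ⟨ε, hε, hH⟩ := hT t ht a
      filter_upwards [Ioo_mem_nhdsGT hε] with x hx
      exact ⟨t, ht, hyt, fun z hz hza => hH z hz (hza.trans hx.2)⟩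
    have hq : 0 < q 0 := (hb 0 trivial).2
    obtain ⟨x, hx, hx0, hxq⟩ := (h1.and (Ioo_mem_nhdsGT hq)).exists
    have hbox : (fun _ : Fin 1 => x) ∈ openBox p q := by
      intro i _
      rw [Subsingleton.elim i 0]
      exact ⟨(hb 0 trivial).1.trans hx0, hxq⟩
    have hSx : Dfn L R (· ∈ S x) := hSd.comp_map (f := fun y => (x, y)) (by fun_prop)
    obtain ⟨hf, hn⟩ := (hST x hx0).finite_of_finitenessBound hDC hSx ha (H _ hbox)
    have := ncard_le_ncard (show T ⊆ S x ∩ Ioo c d from fun y hy => ⟨hx y hy, (hTs hy).2⟩) hf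
    omega
  obtain ⟨ε, hε, hH⟩ := thin_of_finite hfin a
  obtain ⟨δ, hδ, hδI⟩ := (nhds_basis_abs_sub_lt a).mem_iff.1 (isOpen_Ioo.mem_nhds ha)
  obtain ⟨y, hy, hya, hne⟩ := hacc (min ε δ) (lt_min hε hδ)
  exact hne (hH y ⟨hy, hδI (hya.trans_le (min_le_right _ _))⟩ (hya.trans_le (min_le_left _ _)))

theorem exists_gap (hDC : DC L R) {S : Set R} (hd : Dfn L R (· ∈ S)) (hS : IsClosed S) {y w : R}
    (hy : y ∈ S) (hw : w ∉ S) (hyw : y < w) :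
    ∃ m ∈ S, y ≤ m ∧ m < w ∧ ∀ z ∈ S, m < z → w ≤ z := by
  have hd' : Dfn L R (· ∈ S ∩ Iic w) := by
    have : Dfn L R fun x => x ∈ S ∧ x ≤ w := by fun_prop
    exact this
  have hne : (S ∩ Iic w).Nonempty := ⟨y, hy, hyw.le⟩
  obtain ⟨m, hm⟩ := hDC.exists_isLUB hd' hne ⟨w, fun z hz => hz.2⟩
  have hmS := hm.mem_of_isClosed hne (hS.inter isClosed_Iic)
  refine ⟨m, hmS.1, hm.1 ⟨hy, hyw.le⟩, lt_of_le_of_ne hmS.2 fun h => hw (h ▸ hmS.1), ?_⟩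
  intro z hz hmz
  by_contra h
  exact hmz.not_ge (hm.1 ⟨hz, (not_le.1 h).le⟩)

/-- A stand-in for halving, using only density of the order. -/
theorem exists_add_self_le {s : R} (hs : 0 < s) : ∃ ε > 0, ε + ε ≤ s := by
  obtain ⟨e, he, hes⟩ := exists_between hs
  rcases le_total e (s - e) with h | h
  · exact ⟨e, he, by rwa [le_sub_iff_add_le] at h⟩
  · refine ⟨s - e, sub_pos.2 hes, ?_⟩
    have := add_le_add_right h (s - e)
    simpa using this

/-- The points of `S` followed by a gap of length at least `s` are separated by at least `s`, and
these sets form a chain in `s`. So the left endpoints of gaps form a closed discrete set. Since `S`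
has no interior, there is a hole between any two of its points and hence a gap endpoint:
accumulation of `S` would force accumulation of endpoints. -/
theorem thin_of_isClosed (hDC : DC L R) (hL : LUF₂ L R) {S : Set R} (hd : Dfn L R (· ∈ S))
    (hS : IsClosed S) (hi : interior S = ∅) : Thin S := by
  let G : R → Set R := fun s => {y | y ∈ S ∧ ∀ z, z ∈ S → y < z → y + s ≤ z}
  have hGd : Dfn L R fun p : R × R => p.2 ∈ G p.1 := by
    have : Dfn L R fun p : R × R => p.2 ∈ S ∧ ∀ z, z ∈ S → p.2 < z → p.2 + p.1 ≤ z := by fun_prop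
    exact this
  have hGT : ∀ s ∈ Ioi (0 : R), Thin (G s) := by
    intro s hs a
    obtain ⟨ε, hε, hεs⟩ := exists_add_self_le (show 0 < s from hs)
    have key : ∀ y ∈ G s, ∀ z ∈ G s, |y - a| < ε → |z - a| < ε → ¬ y < z := by
      intro y hy z hz hya hza hyz
      have h1 := hy.2 z hz.1 hyz
      rw [abs_sub_lt_iff] at hya hza
      have h2 : z - y < ε + ε := by
        have := add_lt_add hza.1 hya.2
        simpa using this
      have h3 : z < y + s := sub_lt_iff_lt_add'.1 (h2.trans_le hεs)
      exact h3.not_ge h1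
    by_cases hex : ∃ y ∈ G s, |y - a| < ε ∧ y ≠ a
    · obtain ⟨y, hy, hya, hne⟩ := hex
      refine ⟨|y - a|, abs_pos.2 (sub_ne_zero.2 hne), fun z hz hza => ?_⟩
      have h1 := key y hy z hz hya (hza.trans hya)
      have h2 := key z hz y hy (hza.trans hya) hya
      have : z = y := le_antisymm (not_lt.1 h1) (not_lt.1 h2)
      subst this
      exact absurd hza (lt_irrefl _)
    · push Not at hex
      exact ⟨ε, hε, hex⟩
  have hch : ∀ t ∈ Ioi (0 : R), ∀ t' ∈ Ioi (0 : R), G t ⊆ G t' ∨ G t' ⊆ G t := by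
    intro t _ t' _
    rcases le_total t t' with h | h
    · exact Or.inr fun y hy => ⟨hy.1, fun z hz hyz => (add_le_add_right h y).trans (hy.2 z hz hyz)⟩
    · exact Or.inl fun y hy => ⟨hy.1, fun z hz hyz => (add_le_add_right h y).trans (hy.2 z hz hyz)⟩
  have hA := thin_iUnion_chain hDC hL (D := Ioi 0) (by
    have : Dfn L R fun x : R => 0 < x := by fun_prop
    exact this) hGd hGT hch
  have hgap : ∀ {y w}, y ∈ S → w ∉ S → y < w → ∃ m ∈ ⋃ t ∈ Ioi (0 : R), G t, y ≤ m ∧ m < w := by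
    intro y w hy hw hyw
    obtain ⟨m, hm, hym, hmw, H⟩ := exists_gap hDC hd hS hy hw hyw
    refine ⟨m, mem_iUnion₂.2 ⟨w - m, sub_pos.2 hmw, hm, fun z hz hmz => ?_⟩, hym, hmw⟩
    simpa using H z hz hmz
  have hhole : ∀ {y z}, y < z → ∃ w, y < w ∧ w < z ∧ w ∉ S := by
    intro y z hyz
    by_contra! h
    have : Ioo y z ⊆ interior S := interior_maximal (fun w hw => h w hw.1 hw.2) isOpen_Ioo
    rw [hi] at this
    obtain ⟨w, hw⟩ := exists_between hyz
    exact this hw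
  intro a
  by_contra! hacc
  obtain ⟨ε, hε, H⟩ := hA a
  obtain ⟨y, hy, hya, hne⟩ := hacc ε hε
  have hleft : ∀ y ∈ S, |y - a| < ε → ¬ y < a := by
    intro y hy hya hlt
    obtain ⟨w, hyw, hwa, hw⟩ := hhole hlt
    obtain ⟨m, hm, hym, hmw⟩ := hgap hy hw hyw
    have hma := hmw.trans hwa
    refine hma.ne (H m hm ?_)
    rw [abs_sub_comm, abs_of_pos (sub_pos.2 hma)]
    rw [abs_sub_comm, abs_of_pos (sub_pos.2 hlt)] at hya
    exact (sub_le_sub_left hym a).trans_lt hya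
  have hay : a < y := lt_of_le_of_ne (not_lt.1 (hleft y hy hya)) hne.symm
  obtain ⟨w, haw, hwy, hw⟩ := hhole hay
  rw [abs_of_pos (sub_pos.2 hay)] at hya
  have hwε : w - a < ε := (sub_lt_sub_right hwy a).trans hya
  -- To the right of `a` the gap endpoint must stay close to `a` but differ from it, so it is sought
  -- between a second point `z` of `S` and the hole `w` chosen beforehand.
  obtain ⟨z, hz, hza, hzne⟩ := hacc (w - a) (sub_pos.2 haw)
  have haz : a < z := lt_of_le_of_ne (not_lt.1 (hleft z hz (hza.trans hwε))) hzne.symm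
  rw [abs_of_pos (sub_pos.2 haz)] at hza
  obtain ⟨m, hm, hzm, hmw⟩ := hgap hz hw (by simpa using hza)
  have ham := haz.trans_le hzm
  refine ham.ne' (H m hm ?_)
  rw [abs_of_pos (sub_pos.2 ham)]
  exact (sub_lt_sub_right hmw a).trans hwε

end

/-! ### Cubes and coordinate projections -/

section

variable {R : Type w} [AddCommGroup R] [LinearOrder R] {ι κ : Type}

/-- `y` lies in the open cube of radius `ε` around `x`. -/
def Near (ε : R) (x y : ι → R) : Prop := ∀ i, |y i - x i| < ε

/-- The image of `A` under the coordinate map `z ↦ (i ↦ z (e i))`. -/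
def proj (e : κ → ι) (A : Set (ι → R)) : Set (κ → R) := (fun z i => z (e i)) '' A

theorem proj_mono (e : κ → ι) {A B : Set (ι → R)} (h : A ⊆ B) : proj e A ⊆ proj e B :=
  image_mono h

variable [IsOrderedAddMonoid R]

theorem near_comm {ε : R} {x y : ι → R} : Near ε x y ↔ Near ε y x := by
  simp only [Near, abs_sub_comm]

theorem Near.mono {ε δ : R} {x y : ι → R} (h : Near ε x y) (hle : ε ≤ δ) : Near δ x y :=
  fun i => (h i).trans_le hle

theorem near_self {ε : R} (hε : 0 < ε) (x : ι → R) : Near ε x x := fun i => by simpa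

theorem Near.trans {ε δ : R} {x y z : ι → R} (h : Near ε x y) (h' : Near δ y z) :
    Near (ε + δ) x z := fun i => by
  have := (abs_add_le (z i - y i) (y i - x i)).trans_lt (add_lt_add (h' i) (h i))
  simpa [add_comm] using this

variable [Finite ι] [Finite κ]

theorem exists_abs_le (z : ι → R) : ∃ M, ∀ i, |z i| ≤ M := by
  obtain ⟨M, hM⟩ := (finite_range fun i => |z i|).bddAbove
  exact ⟨M, fun i => hM (mem_range_self i)⟩

variable [TopologicalSpace R] [OrderTopology R]

theorem isOpen_near (ε : R) (x : ι → R) : IsOpen {y | Near ε x y} := by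
  simp only [Near, ofPred_forall]
  exact isOpen_iInter_of_finite fun i => isOpen_lt (by fun_prop) continuous_const

variable [DenselyOrdered R] [Nontrivial R]

theorem nhds_basis_near (x : ι → R) : (𝓝 x).HasBasis (fun ε : R => 0 < ε) fun ε => {y | Near ε x y} := by
  refine ⟨fun s => ⟨fun hs => ?_, ?_⟩⟩
  · rw [nhds_pi, Filter.mem_pi] at hs
    obtain ⟨I, -, t, ht, hts⟩ := hs
    have : ∀ᶠ ε in 𝓝[>] (0 : R), ∀ i, ∀ y, |y - x i| < ε → y ∈ t i := by
      rw [eventually_all]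
      intro i
      obtain ⟨ε, hε, H⟩ := (nhds_basis_abs_sub_lt (x i)).mem_iff.1 (ht i)
      filter_upwards [Ioo_mem_nhdsGT hε] with δ hδ y hy
      exact H (hy.trans hδ.2)
    obtain ⟨ε, hε, hε0⟩ := (this.and self_mem_nhdsWithin).exists
    exact ⟨ε, hε0, fun y hy => hts fun i _ => hε i _ (hy i)⟩
  · rintro ⟨ε, hε, h⟩
    exact mem_of_superset ((isOpen_near ε x).mem_nhds (near_self hε x)) h

theorem mem_closure_iff_near {A : Set (ι → R)} {x : ι → R} :
    x ∈ closure A ↔ ∀ ε, 0 < ε → ∃ y, y ∈ A ∧ Near ε x y := by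
  rw [mem_closure_iff_nhds_basis (nhds_basis_near x)]
  rfl

theorem mem_interior_iff_near {A : Set (ι → R)} {x : ι → R} :
    x ∈ interior A ↔ ∃ ε, 0 < ε ∧ ∀ y, Near ε x y → y ∈ A := by
  rw [mem_interior_iff_mem_nhds, (nhds_basis_near x).mem_iff]
  rfl

theorem eq_of_near {x y : ι → R} (h : ∀ ε, 0 < ε → Near (ε + ε) x y) : x = y := by
  ext i
  by_contra hne
  obtain ⟨ε, hε, hle⟩ := exists_add_self_le (abs_pos.2 (sub_ne_zero.2 (Ne.symm hne)))
  exact (h ε hε i).not_ge hle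

end

/-! ### Definable compactness -/

section

variable {L : FirstOrder.Language.{u, v}} {R : Type w} [L.Structure R] [AddCommGroup R]
  [LinearOrder R] [IsOrderedAddMonoid R] [DefinableOAG L R] {Γ : Type w} [Ctx R Γ]
  {ι κ : Type} [Finite ι] [Finite κ]

@[fun_prop]
theorem Dfn.near {ε : Γ → R} {f g : Γ → ι → R} (hε : DMap L R ε) (hf : DMap L R f)
    (hg : DMap L R g) : Dfn L R fun x => Near (ε x) (f x) (g x) :=
  Dfn.all_finite fun i => by fun_prop

theorem DC.exists_coord_cluster (hDC : DC L R) {F : R → Set (ι → R)}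
    (hF : Dfn L R fun p : R × (ι → R) => p.2 ∈ F p.1) (hne : ∀ t, 0 < t → (F t).Nonempty)
    (hmono : ∀ t t', 0 < t → t ≤ t' → F t ⊆ F t') (i : ι) {M : R}
    (hM : ∀ t, 0 < t → ∀ z ∈ F t, |z i| ≤ M) :
    ∃ c, ∀ t, 0 < t → ∃ z ∈ F t, |z i - c| < t := by
  by_cases htr : ∃ t : R, 0 < t
  swap
  · exact ⟨0, fun t ht => absurd ⟨t, ht⟩ htr⟩
  obtain ⟨t₁, ht₁⟩ := htr
  -- The supremum of `C` is the upper limit of the `i`-th coordinate over `F t` as `t` tends to `0`.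
  let C : Set R := {c | ∀ t, 0 < t → ∃ z, z ∈ F t ∧ c ≤ z i}
  have hC : Dfn L R (· ∈ C) := by
    have h1 : Dfn L R fun p : (R × R) × (ι → R) => p.2 ∈ F p.1.2 :=
      hF.comp_map (f := fun p : (R × R) × (ι → R) => (p.1.2, p.2)) (by fun_prop)
    exact Dfn.all (Dfn.imp (by fun_prop) (Dfn.ex (h1.and (by fun_prop))))
  obtain ⟨c, hc⟩ := hDC.exists_isLUB hC ⟨-M, fun t ht => by
      obtain ⟨z, hz⟩ := hne t ht
      exact ⟨z, hz, (abs_le.1 (hM t ht z hz)).1⟩⟩ ⟨M, fun c hc => by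
      obtain ⟨z, hz, hcz⟩ := hc t₁ ht₁
      exact hcz.trans (abs_le.1 (hM t₁ ht₁ z hz)).2⟩
  refine ⟨c, fun t ht => ?_⟩
  have h1 : c + t ∉ C := fun h => (hc.1 h).not_gt (lt_add_of_pos_right c ht)
  have h1' : ∃ t₀, 0 < t₀ ∧ ∀ z ∈ F t₀, z i < c + t := by
    by_contra! h
    exact h1 h
  obtain ⟨t₀, ht₀, H⟩ := h1'
  obtain ⟨c', hc', hcc, -⟩ := hc.exists_between (sub_lt_self c ht)
  obtain ⟨z, hz, hcz⟩ := hc' (min t t₀) (lt_min ht ht₀)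
  refine ⟨z, hmono _ _ (lt_min ht ht₀) (min_le_left _ _) hz, ?_⟩
  rw [abs_sub_lt_iff]
  exact ⟨sub_lt_iff_lt_add'.2 (H z (hmono _ _ (lt_min ht ht₀) (min_le_right _ _) hz)),
    sub_lt_comm.1 (hcc.trans_le hcz)⟩

/-- Definable compactness of bounded subsets of `R ^ ι`. -/
theorem DC.exists_cluster (hDC : DC L R) {F : R → Set (ι → R)}
    (hF : Dfn L R fun p : R × (ι → R) => p.2 ∈ F p.1) (hne : ∀ t, 0 < t → (F t).Nonempty)
    (hmono : ∀ t t', 0 < t → t ≤ t' → F t ⊆ F t') {M : R}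
    (hM : ∀ t, 0 < t → ∀ z ∈ F t, ∀ i, |z i| ≤ M) :
    ∃ x, ∀ t, 0 < t → ∃ z ∈ F t, Near t x z := by
  classical
  cases nonempty_fintype ι
  suffices h : ∀ J : Finset ι, ∃ x : ι → R, ∀ t, 0 < t → ∃ z ∈ F t, ∀ i ∈ J, |z i - x i| < t by
    obtain ⟨x, hx⟩ := h Finset.univ
    exact ⟨x, fun t ht => let ⟨z, hz, h⟩ := hx t ht; ⟨z, hz, fun i => h i (Finset.mem_univ i)⟩⟩
  intro J
  induction J using Finset.induction_on with
  | empty => exact ⟨0, fun t ht => let ⟨z, hz⟩ := hne t ht; ⟨z, hz, by simp⟩⟩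
  | insert j J hj ih =>
    obtain ⟨x, hx⟩ := ih
    -- The family is first cut down to points whose earlier coordinates are already within `t` of
    -- their limits, so that treating coordinate `j` preserves them.
    have hd : Dfn L R fun p : R × (ι → R) =>
        p.2 ∈ {z | z ∈ F p.1 ∧ ∀ i, i ∈ J → |z i - x i| < p.1} :=
      hF.and (Dfn.all_finite fun i => Dfn.imp (Dfn.const _) (by fun_prop))
    obtain ⟨c, hc⟩ := hDC.exists_coord_cluster hd hx
      (fun t t' ht htt z hz => ⟨hmono t t' ht htt hz.1, fun i hi => (hz.2 i hi).trans_le htt⟩) j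
      (M := M) fun t ht z hz => hM t ht z hz.1 j
    refine ⟨Function.update x j c, fun t ht => ?_⟩
    obtain ⟨z, hz, hzc⟩ := hc t ht
    refine ⟨z, hz.1, fun i hi => ?_⟩
    rcases eq_or_ne i j with rfl | hij
    · simpa using hzc
    · simpa [hij] using hz.2 i (Finset.mem_of_mem_insert_of_ne hi hij)

variable [DenselyOrdered R] [Nontrivial R] [TopologicalSpace R] [OrderTopology R]

theorem Dfn.closure {A : Set (ι → R)} (hA : Dfn L R (· ∈ A)) : Dfn L R (· ∈ closure A) := by
  simp only [mem_closure_iff_near]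
  fun_prop

theorem Dfn.interior {A : Set (ι → R)} (hA : Dfn L R (· ∈ A)) : Dfn L R (· ∈ interior A) := by
  simp only [mem_interior_iff_near]
  fun_prop

/-- Approximate preimages of a point of the closure cluster at a point of `K`, which must be an
exact preimage. -/
theorem DC.isClosed_proj (hDC : DC L R) {K : Set (ι → R)} (hK : Dfn L R (· ∈ K))
    (hc : IsClosed K) {M : R} (hM : ∀ z ∈ K, ∀ i, |z i| ≤ M) (e : κ → ι) :
    IsClosed (proj e K) := by
  refine isClosed_of_closure_subset fun y hy => ?_
  rw [mem_closure_iff_near] at hy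
  have hd : Dfn L R fun p : R × (ι → R) => p.2 ∈ {z | z ∈ K ∧ Near p.1 y (fun i => z (e i))} := by
    have : Dfn L R fun p : R × (ι → R) => p.2 ∈ K ∧ Near p.1 y (fun i => p.2 (e i)) := by fun_prop
    exact this
  obtain ⟨x, hx⟩ := hDC.exists_cluster (F := fun t => {z | z ∈ K ∧ Near t y (fun i => z (e i))}) hd (fun t ht => by
      obtain ⟨_, ⟨z, hz, rfl⟩, h⟩ := hy t ht
      exact ⟨z, hz, h⟩) (fun t t' ht htt z hz => ⟨hz.1, hz.2.mono htt⟩) (M := M)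
      fun t ht z hz => hM z hz.1
  refine ⟨x, hc.closure_subset (mem_closure_iff_near.2 fun ε hε => ?_), ?_⟩
  · obtain ⟨z, hz, h⟩ := hx ε hε
    exact ⟨z, hz.1, h⟩
  · refine (eq_of_near fun ε hε => ?_).symm
    obtain ⟨z, hz, h⟩ := hx ε hε
    exact hz.2.trans (near_comm.1 fun i => h (e i))

/-- If a coordinate projection of a closed bounded definable set has interior, so does the
projection of a part of it on which a given coordinate varies little. -/
theorem DC.exists_localize_coord (hDC : DC L R) {K : Set (ι → R)} (hK : Dfn L R (· ∈ K))
    (hc : IsClosed K) {M : R} (hM : ∀ z ∈ K, ∀ i, |z i| ≤ M) (e : κ → ι)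
    (hi : (interior (proj e K)).Nonempty) {t : R} (ht : 0 < t) (j : ι) :
    ∃ c, (interior (proj e (K ∩ {z | |z j - c| ≤ t}))).Nonempty := by
  -- The infimum of `Q` is the threshold at which interior first appears when sweeping the `j`-th
  -- coordinate upwards. Interior is absent at `c - t` and present below `c + t`, so the slab in
  -- between must carry it.
  let Q : Set R := {k | ∃ x, x ∈ interior (proj e (K ∩ {z | z j ≤ k}))}
  have hQ : Dfn L R (· ∈ Q) := by
    have : Dfn L R fun k : R => ∃ x : κ → R, ∃ δ : R, 0 < δ ∧ ∀ y : κ → R, Near δ x y →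
      ∃ z : ι → R, (z ∈ K ∧ z j ≤ k) ∧ (fun i => z (e i)) = y := by fun_prop
    refine this.congr fun k => exists_congr fun x => ?_
    rw [mem_interior_iff_near]
    rfl
  have hMQ : ∀ k, M ≤ k → k ∈ Q := fun k hk => by
    obtain ⟨x, hx⟩ := hi
    refine ⟨x, interior_mono (proj_mono e ?_) hx⟩
    exact fun z hz => ⟨hz, ((abs_le.1 (hM z hz j)).2).trans hk⟩
  have hQb : BddBelow Q := by
    refine ⟨-M, fun k hk => ?_⟩
    obtain ⟨x, hx⟩ := hk
    obtain ⟨z, hz, -⟩ := interior_subset hx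
    exact (abs_le.1 (hM z hz.1 j)).1.trans hz.2
  obtain ⟨c, hc'⟩ := hDC.exists_isGLB hQ ⟨M, hMQ M le_rfl⟩ hQb
  obtain ⟨k, hk, -, hkc⟩ := hc'.exists_between (lt_add_of_pos_right c ht)
  have h1 : c - t ∉ Q := fun h => (hc'.1 h).not_gt (sub_lt_self c ht)
  refine ⟨c, ?_⟩
  have h2 : interior (proj e (K ∩ {z | z j ≤ c - t})) = ∅ := by
    by_contra h
    exact h1 (nonempty_iff_ne_empty.2 h)
  have hcl : IsClosed (proj e (K ∩ {z | |z j - c| ≤ t})) := by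
    refine hDC.isClosed_proj ?_ (hc.inter (isClosed_le (by fun_prop) continuous_const))
      (fun z hz => hM z hz.1) e
    have : Dfn L R fun z : ι → R => z ∈ K ∧ |z j - c| ≤ t := by fun_prop
    exact this
  -- Adding a set without interior to a closed set creates no new interior; closedness of the slab's
  -- projection is what makes this legitimate.
  rw [← interior_union_isClosed_of_interior_empty hcl h2]
  obtain ⟨x, hx⟩ := hk
  refine ⟨x, interior_mono ?_ hx⟩
  rw [proj, proj, proj, ← image_union, ← inter_union_distrib_left]
  refine image_mono fun z hz => ⟨hz.1, ?_⟩
  have h3 : z j ≤ k := hz.2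
  rcases le_total (z j) (c - t) with h | h
  · exact Or.inr h
  · refine Or.inl (abs_sub_le_iff.2 ⟨?_, sub_le_comm.1 h⟩)
    exact sub_le_iff_le_add'.2 (h3.trans hkc.le)

theorem DC.exists_localize (hDC : DC L R) {K : Set (ι → R)} (hK : Dfn L R (· ∈ K))
    (hc : IsClosed K) {M : R} (hM : ∀ z ∈ K, ∀ i, |z i| ≤ M) (e : κ → ι)
    (hi : (interior (proj e K)).Nonempty) {t : R} (ht : 0 < t) :
    ∃ x : ι → R, (interior (proj e (K ∩ {z | ∀ i, |z i - x i| ≤ t}))).Nonempty := by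
  classical
  cases nonempty_fintype ι
  suffices h : ∀ J : Finset ι, ∃ x : ι → R,
      (interior (proj e (K ∩ {z | ∀ i ∈ J, |z i - x i| ≤ t}))).Nonempty by
    simpa using h Finset.univ
  intro J
  induction J using Finset.induction_on with
  | empty => simpa using hi
  | insert j J hj ih =>
    obtain ⟨x, hx⟩ := ih
    have hd : Dfn L R (· ∈ K ∩ {z | ∀ i ∈ J, |z i - x i| ≤ t}) :=
      hK.and (Dfn.all_finite fun i => Dfn.imp (Dfn.const _) (by fun_prop))
    have hcl : IsClosed (K ∩ {z | ∀ i ∈ J, |z i - x i| ≤ t}) := by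
      refine hc.inter ?_
      simp only [ofPred_forall]
      exact isClosed_biInter fun i _ => isClosed_le (by fun_prop) continuous_const
    obtain ⟨c, hc'⟩ := hDC.exists_localize_coord hd hcl (fun z hz => hM z hz.1) e hx ht j
    refine ⟨Function.update x j c, hc'.mono (interior_mono (proj_mono e ?_))⟩
    rintro z ⟨⟨hz, hz'⟩, hzc⟩
    refine ⟨hz, fun i hi => ?_⟩
    rcases eq_or_ne i j with rfl | hij
    · simpa using hzc
    · simpa [hij] using hz' i (Finset.mem_of_mem_insert_of_ne hi hij)

end

/-! ### Definable analogues of σ-compact sets -/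

/-- `A` is the union of the sets `F r s` for `0 < s`, which form a definable family of closed bounded
sets, increasing in `r` and decreasing in `s`. -/
structure DFam (L : FirstOrder.Language.{u, v}) {R : Type w} [L.Structure R] [AddCommGroup R]
    [LinearOrder R] [TopologicalSpace R] {ι : Type} [Finite ι] (A : Set (ι → R))
    (F : R → R → Set (ι → R)) : Prop where
  dfn : Dfn L R fun p : R × R × (ι → R) => p.2.2 ∈ F p.1 p.2.1
  isClosed : ∀ r s, 0 < s → IsClosed (F r s)
  bdd : ∀ r s, 0 < s → ∃ M, ∀ z ∈ F r s, ∀ i, |z i| ≤ M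
  mono : ∀ r r' s s', 0 < s' → s' ≤ s → r ≤ r' → F r s ⊆ F r' s'
  mem_iff : ∀ z, z ∈ A ↔ ∃ r s, 0 < s ∧ z ∈ F r s

/-- The class of sets admitting a presentation as in `DFam`. -/
def DSig (L : FirstOrder.Language.{u, v}) {R : Type w} [L.Structure R] [AddCommGroup R]
    [LinearOrder R] [TopologicalSpace R] {ι : Type} [Finite ι] (A : Set (ι → R)) : Prop :=
  ∃ F, DFam L A F

section

variable {L : FirstOrder.Language.{u, v}} {R : Type w} [L.Structure R] [AddCommGroup R]
  [LinearOrder R] [IsOrderedAddMonoid R] [DefinableOAG L R] [DenselyOrdered R] [Nontrivial R]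
  [TopologicalSpace R] [OrderTopology R] {Γ : Type w} [Ctx R Γ] {ι κ : Type} [Finite ι] [Finite κ]
  {A B : Set (ι → R)} {F : R → R → Set (ι → R)}

theorem DFam.mem (hF : DFam L A F) {r s : Γ → R} {f : Γ → ι → R} (hr : DMap L R r)
    (hs : DMap L R s) (hf : DMap L R f) : Dfn L R fun x => f x ∈ F (r x) (s x) :=
  hF.dfn.comp_map (f := fun x => (r x, s x, f x)) (by fun_prop)

theorem DFam.subset (hF : DFam L A F) {r s : R} (hs : 0 < s) : F r s ⊆ A :=
  fun z hz => (hF.mem_iff z).2 ⟨r, s, hs, hz⟩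

theorem DSig.dfn (hA : DSig L A) : Dfn L R (· ∈ A) := by
  obtain ⟨F, hF⟩ := hA
  have : Dfn L R fun z : ι → R => ∃ r s : R, 0 < s ∧ z ∈ F r s :=
    Dfn.ex (Dfn.ex (Dfn.and (by fun_prop) (hF.mem (by fun_prop) (by fun_prop) (by fun_prop))))
  exact this.congr hF.mem_iff

theorem dfn_cube (x : ι → R) (δ : R) : Dfn L R (· ∈ {y : ι → R | ∀ i, |y i - x i| ≤ δ}) := by
  have : Dfn L R fun y : ι → R => ∀ i, |y i - x i| ≤ δ := Dfn.all_finite fun i => by fun_prop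
  exact this

theorem isClosed_cube (x : ι → R) (δ : R) : IsClosed {y : ι → R | ∀ i, |y i - x i| ≤ δ} := by
  simp only [ofPred_forall]
  exact isClosed_iInter fun i => isClosed_le (by fun_prop) continuous_const

theorem DSig.of_isClosed (hd : Dfn L R (· ∈ A)) (hc : IsClosed A) : DSig L A := by
  refine ⟨fun r _ => A ∩ {y | ∀ i, |y i - 0| ≤ r}, ?_, fun r s _ => hc.inter (isClosed_cube 0 r),
    fun r s _ => ⟨r, fun z hz i => by simpa using hz.2 i⟩,
    fun r r' s s' _ _ hr z hz => ⟨hz.1, fun i => (hz.2 i).trans hr⟩, fun z => ?_⟩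
  · have : Dfn L R fun p : R × R × (ι → R) => p.2.2 ∈ A ∧ ∀ i, |p.2.2 i - 0| ≤ p.1 :=
      Dfn.and (by fun_prop) (Dfn.all_finite fun i => by fun_prop)
    exact this
  · constructor
    · intro hz
      obtain ⟨M, hM⟩ := exists_abs_le z
      obtain ⟨s, hs⟩ := exists_gt (0 : R)
      exact ⟨M, s, hs, hz, fun i => by simpa using hM i⟩
    · rintro ⟨r, s, -, hz⟩
      exact hz.1

/-- Exhaust `A` by the points of a bounded cube whose open `s`-cube stays in `A`; each such set is
closed as an intersection of complements of open cubes. -/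
theorem DSig.of_isOpen (hd : Dfn L R (· ∈ A)) (ho : IsOpen A) : DSig L A := by
  refine ⟨fun r s => {y | (∀ i, |y i - 0| ≤ r) ∧ ∀ z, Near s y z → z ∈ A}, ?_, fun r s _ => ?_,
    fun r s _ => ⟨r, fun z hz i => by simpa using hz.1 i⟩,
    fun r r' s s' _ hs hr y hy => ⟨fun i => (hy.1 i).trans hr, fun z hz => hy.2 z (hz.mono hs)⟩,
    fun z => ?_⟩
  · have : Dfn L R fun p : R × R × (ι → R) => (∀ i, |p.2.2 i - 0| ≤ p.1) ∧
        ∀ z : ι → R, Near p.2.1 p.2.2 z → z ∈ A :=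
      Dfn.and (Dfn.all_finite fun i => by fun_prop) (by fun_prop)
    exact this
  · refine (isClosed_cube 0 r).inter (s₂ := {y | ∀ z, Near s y z → z ∈ A}) ?_
    simp only [ofPred_forall]
    refine isClosed_iInter fun z => ?_
    by_cases hz : z ∈ A
    · simp [hz]
    · simp only [hz, imp_false]
      have := (isOpen_near s z).isClosed_compl
      simp only [near_comm (x := z)] at this
      exact this
  · constructor
    · intro hz
      obtain ⟨M, hM⟩ := exists_abs_le z
      obtain ⟨s, hs, H⟩ := mem_interior_iff_near.1 (ho.interior_eq.symm ▸ hz)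
      exact ⟨M, s, hs, fun i => by simpa using hM i, H⟩
    · rintro ⟨r, s, hs, hz⟩
      exact hz.2 z (near_self hs z)

theorem DSig.inter (hA : DSig L A) (hB : DSig L B) : DSig L (A ∩ B) := by
  obtain ⟨F, hF⟩ := hA
  obtain ⟨G, hG⟩ := hB
  refine ⟨fun r s => F r s ∩ G r s, hF.dfn.and hG.dfn,
    fun r s hs => (hF.isClosed r s hs).inter (hG.isClosed r s hs), fun r s hs => ?_,
    fun r r' s s' h1 h2 h3 => inter_subset_inter (hF.mono r r' s s' h1 h2 h3)
      (hG.mono r r' s s' h1 h2 h3), fun z => ⟨?_, ?_⟩⟩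
  · obtain ⟨M, hM⟩ := hF.bdd r s hs
    exact ⟨M, fun z hz => hM z hz.1⟩
  · rintro ⟨hzA, hzB⟩
    obtain ⟨r, s, hs, hz⟩ := (hF.mem_iff z).1 hzA
    obtain ⟨r', s', hs', hz'⟩ := (hG.mem_iff z).1 hzB
    exact ⟨max r r', min s s', lt_min hs hs',
      hF.mono _ _ _ _ (lt_min hs hs') (min_le_left _ _) (le_max_left _ _) hz,
      hG.mono _ _ _ _ (lt_min hs hs') (min_le_right _ _) (le_max_right _ _) hz'⟩
  · rintro ⟨r, s, hs, hz⟩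
    exact ⟨hF.subset hs hz.1, hG.subset hs hz.2⟩

theorem DSig.union (hA : DSig L A) (hB : DSig L B) : DSig L (A ∪ B) := by
  obtain ⟨F, hF⟩ := hA
  obtain ⟨G, hG⟩ := hB
  refine ⟨fun r s => F r s ∪ G r s, hF.dfn.or hG.dfn,
    fun r s hs => (hF.isClosed r s hs).union (hG.isClosed r s hs), fun r s hs => ?_,
    fun r r' s s' h1 h2 h3 => union_subset_union (hF.mono r r' s s' h1 h2 h3)
      (hG.mono r r' s s' h1 h2 h3), fun z => ⟨?_, ?_⟩⟩
  · obtain ⟨M, hM⟩ := hF.bdd r s hs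
    obtain ⟨M', hM'⟩ := hG.bdd r s hs
    refine ⟨max M M', ?_⟩
    rintro z (hz | hz) i
    · exact (hM z hz i).trans (le_max_left _ _)
    · exact (hM' z hz i).trans (le_max_right _ _)
  · rintro (h | h)
    · obtain ⟨r, s, hs, hz⟩ := (hF.mem_iff z).1 h
      exact ⟨r, s, hs, Or.inl hz⟩
    · obtain ⟨r, s, hs, hz⟩ := (hG.mem_iff z).1 h
      exact ⟨r, s, hs, Or.inr hz⟩
  · rintro ⟨r, s, hs, hz | hz⟩
    · exact Or.inl (hF.subset hs hz)
    · exact Or.inr (hG.subset hs hz)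

/-- The members of a `DFam` are required to be bounded for this purpose: only then are their
projections known to be closed. -/
theorem DFam.proj (hDC : DC L R) (hF : DFam L A F) (e : κ → ι) :
    DFam L (proj e A) fun r s => LocOMin.proj e (F r s) := by
  have hd (r s : R) : Dfn L R (· ∈ F r s) := hF.mem (by fun_prop) (by fun_prop) (by fun_prop)
  refine ⟨?_, fun r s hs => ?_, fun r s hs => ?_,
    fun r r' s s' h1 h2 h3 => proj_mono e (hF.mono r r' s s' h1 h2 h3), fun z => ⟨?_, ?_⟩⟩
  · have : Dfn L R fun p : R × R × (κ → R) => ∃ z : ι → R, z ∈ F p.1 p.2.1 ∧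
        (fun i => z (e i)) = p.2.2 :=
      Dfn.ex ((hF.mem (by fun_prop) (by fun_prop) (by fun_prop)).and (by fun_prop))
    exact this
  · obtain ⟨M, hM⟩ := hF.bdd r s hs
    exact hDC.isClosed_proj (hd r s) (hF.isClosed r s hs) hM e
  · obtain ⟨M, hM⟩ := hF.bdd r s hs
    refine ⟨M, ?_⟩
    rintro _ ⟨z, hz, rfl⟩ i
    exact hM z hz (e i)
  · rintro ⟨z, hz, rfl⟩
    obtain ⟨r, s, hs, hz⟩ := (hF.mem_iff z).1 hz
    exact ⟨r, s, hs, z, hz, rfl⟩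
  · rintro ⟨r, s, hs, z, hz, rfl⟩
    exact ⟨z, hF.subset hs hz, rfl⟩

theorem DSig.proj (hDC : DC L R) (hA : DSig L A) (e : κ → ι) : DSig L (proj e A) :=
  let ⟨_, hF⟩ := hA
  ⟨_, hF.proj hDC e⟩

theorem DSig.preimage {A : Set (κ → R)} (hA : DSig L A) (e : κ → ι) :
    DSig L {z : ι → R | (fun i => z (e i)) ∈ A} := by
  obtain ⟨F, hF⟩ := hA
  refine ⟨fun r s => {y | (∀ i, |y i - 0| ≤ r) ∧ (fun i => y (e i)) ∈ F r s}, ?_, fun r s hs => ?_,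
    fun r s _ => ⟨r, fun z hz i => by simpa using hz.1 i⟩,
    fun r r' s s' h1 h2 h3 y hy => ⟨fun i => (hy.1 i).trans h3, hF.mono r r' s s' h1 h2 h3 hy.2⟩,
    fun z => ⟨fun hz => ?_, ?_⟩⟩
  · exact Dfn.and (Dfn.all_finite fun i => by fun_prop)
      (hF.mem (by fun_prop) (by fun_prop) (by fun_prop))
  · exact (isClosed_cube 0 r).inter ((hF.isClosed r s hs).preimage (by fun_prop))
  · obtain ⟨M, hM⟩ := exists_abs_le z
    obtain ⟨r, s, hs, hz⟩ := (hF.mem_iff _).1 hz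
    exact ⟨max M r, s, hs, fun i => by simpa using Or.inl (hM i),
      hF.mono _ _ _ _ hs le_rfl (le_max_right _ _) hz⟩
  · rintro ⟨r, s, hs, hz⟩
    exact hF.subset hs hz.2

/-- The chain lemma is used twice: first over `s` with `r` fixed, then over `r`. -/
theorem thin_iUnion_family (hDC : DC L R) (hL : LUF₂ L R) {F : R → R → Set R}
    (hd : Dfn L R fun p : R × R × R => p.2.2 ∈ F p.1 p.2.1)
    (hc : ∀ r s, 0 < s → IsClosed (F r s)) (hi : ∀ r s, 0 < s → interior (F r s) = ∅)
    (hmono : ∀ r r' s s', 0 < s' → s' ≤ s → r ≤ r' → F r s ⊆ F r' s') :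
    Thin {y | ∃ r s, 0 < s ∧ y ∈ F r s} := by
  have hpos : Dfn L R (· ∈ Ioi (0 : R)) := by
    have : Dfn L R fun x : R => 0 < x := by fun_prop
    exact this
  have h1 : ∀ r, Thin (⋃ s ∈ Ioi (0 : R), F r s) := by
    intro r
    refine thin_iUnion_chain hDC hL hpos
      (hd.comp_map (f := fun p : R × R => (r, p.1, p.2)) (by fun_prop)) (fun s hs => ?_) ?_
    · refine thin_of_isClosed hDC hL ?_ (hc r s hs) (hi r s hs)
      exact hd.comp_map (f := fun y : R => (r, s, y)) (by fun_prop)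
    · intro t ht t' ht'
      rcases le_total t t' with h | h
      · exact Or.inr (hmono r r t' t ht h le_rfl)
      · exact Or.inl (hmono r r t t' ht' h le_rfl)
  have h2 := thin_iUnion_chain hDC hL (D := univ) (F := fun r => ⋃ s ∈ Ioi (0 : R), F r s)
    (Dfn.const True) ?_ (fun r _ => h1 r) ?_
  · refine h2.mono ?_
    rintro y ⟨r, s, hs, hy⟩
    exact mem_iUnion₂.2 ⟨r, trivial, mem_iUnion₂.2 ⟨s, hs, hy⟩⟩
  · have : Dfn L R fun p : R × R => ∃ s : R, 0 < s ∧ p.2 ∈ F p.1 s :=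
      Dfn.ex (Dfn.and (by fun_prop)
        (hd.comp_map (f := fun p : (R × R) × R => (p.1.1, p.2, p.1.2)) (by fun_prop)))
    refine this.congr fun p => ?_
    simp
  · intro r _ r' _
    rcases le_total r r' with h | h
    · exact Or.inl (iUnion₂_mono fun s hs => hmono r r' s s hs le_rfl h)
    · exact Or.inr (iUnion₂_mono fun s hs => hmono r' r s s hs le_rfl h)

theorem exists_cube_subset {V : Set (ι → R)} (hV : IsOpen V) {x : ι → R} (hx : x ∈ V) :
    ∃ δ > 0, {y | ∀ i, |y i - x i| ≤ δ} ⊆ V := by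
  obtain ⟨ε, hε, H⟩ := (nhds_basis_near x).mem_iff.1 (hV.mem_nhds hx)
  obtain ⟨δ, hδ, hδε⟩ := exists_between hε
  exact ⟨δ, hδ, fun y hy => H fun i => (hy i).trans_lt hδε⟩

/-! ### The Baire property -/

/-- The Baire property of definable families in dimension `n`. -/
def Baire (L : FirstOrder.Language.{u, v}) (R : Type w) [L.Structure R] [AddCommGroup R]
    [LinearOrder R] [TopologicalSpace R] (n : ℕ) : Prop :=
  ∀ (A : Set (Fin n → R)) (F : R → R → Set (Fin n → R)), DFam L A F →
    (∀ r s, 0 < s → interior (F r s) = ∅) → interior (closure A) = ∅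

variable {n : ℕ}

/-- The Baire property makes a pointwise `t` locally uniform. If every `Z t` were dense in `V`, each
would have dense interior in a closed cube, since a `DSig` set without interior is nowhere dense.
The complements of these interiors in the cube would then form a family without interior that still
covers the cube. -/
theorem Baire.exists_avoid (hB : Baire L R n) {Z : R → Set (Fin n → R)}
    (hZd : Dfn L R fun p : R × (Fin n → R) => p.2 ∈ Z p.1) (hZ : ∀ t, 0 < t → DSig L (Z t))
    (hmono : ∀ t t', 0 < t → t ≤ t' → Z t ⊆ Z t') {V : Set (Fin n → R)} (hV : IsOpen V)
    (hne : V.Nonempty) (hVZ : ∀ x ∈ V, ∃ t, 0 < t ∧ x ∉ Z t) :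
    ∃ t, 0 < t ∧ ∃ V' ⊆ V, IsOpen V' ∧ V'.Nonempty ∧ ∀ x ∈ V', x ∉ Z t := by
  by_contra! hcon
  obtain ⟨x₀, hx₀⟩ := hne
  obtain ⟨δ, hδ, hC⟩ := exists_cube_subset hV hx₀
  set C : Set (Fin n → R) := {y | ∀ i, |y i - x₀ i| ≤ δ} with hCdef
  have hWi : ∀ t, 0 < t → interior (C \ interior (Z t)) = ∅ := by
    intro t ht
    by_contra hne
    obtain ⟨x₁, hx₁⟩ := nonempty_iff_ne_empty.2 hne
    set O := interior (C \ interior (Z t)) with hO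
    have hOs : O ⊆ C \ interior (Z t) := interior_subset
    obtain ⟨ε, hε, hC'⟩ := exists_cube_subset isOpen_interior hx₁
    set C' : Set (Fin n → R) := {y | ∀ i, |y i - x₁ i| ≤ ε}
    obtain ⟨F, hF⟩ := (hZ t ht).inter (DSig.of_isClosed (dfn_cube x₁ ε) (isClosed_cube x₁ ε))
    have h1 := hB _ F hF fun r s hs => by
      rw [eq_empty_iff_forall_notMem]
      intro x hx
      have h2 : x ∈ Z t ∩ C' := hF.subset hs (interior_subset hx)
      refine (hOs (hC' h2.2)).2 (interior_mono ?_ hx)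
      exact (hF.subset hs).trans inter_subset_left
    have h2 : {y | Near ε x₁ y} ⊆ closure (Z t ∩ C') := by
      intro y hy
      rw [mem_closure_iff]
      intro U hU hyU
      have h3 : U ∩ {y | Near ε x₁ y} ⊆ C' := fun z hz i => (hz.2 i).le
      obtain ⟨z, hz, hzZ⟩ := hcon t ht (U ∩ {y | Near ε x₁ y})
        (fun z hz => hC (hOs (hC' (h3 hz))).1) (hU.inter (isOpen_near _ _)) ⟨y, hyU, hy⟩
      exact ⟨z, hz.1, hzZ, h3 hz⟩
    have h3 : x₁ ∈ interior (closure (Z t ∩ C')) :=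
      interior_maximal h2 (isOpen_near _ _) (near_self hε x₁)
    rw [h1] at h3
    exact h3
  have hfam : DFam L {x | ∃ _ s : R, 0 < s ∧ x ∈ C \ interior (Z s)}
      fun _ s => C \ interior (Z s) := by
    refine ⟨?_, fun r s hs => (isClosed_cube _ _).sdiff isOpen_interior, fun r s hs => ?_, ?_,
      fun z => Iff.rfl⟩
    · have h1 : Dfn L R fun p : R × R × (Fin n → R) => ∃ ε : R, 0 < ε ∧ ∀ y : Fin n → R,
          Near ε p.2.2 y → y ∈ Z p.2.1 :=
        Dfn.ex (Dfn.and (by fun_prop) (Dfn.all (Dfn.imp (by fun_prop) (hZd.comp_map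
          (f := fun p : ((R × R × (Fin n → R)) × R) × (Fin n → R) => (p.1.1.2.1, p.2))
          (by fun_prop)))))
      have h2 := ((dfn_cube (L := L) x₀ δ).comp_map
        (f := fun p : R × R × (Fin n → R) => p.2.2) (by fun_prop)).and h1.not
      refine h2.congr fun p => ?_
      rw [← mem_interior_iff_near]
      rfl
    · obtain ⟨M, hM⟩ := exists_abs_le x₀
      refine ⟨δ + M, fun z hz i => ?_⟩
      have := (abs_add_le (z i - x₀ i) (x₀ i)).trans (add_le_add (hz.1 i) (hM i))
      rwa [sub_add_cancel] at this
    · intro r r' s s' hs' hss _ x hx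
      exact ⟨hx.1, fun h => hx.2 (interior_mono (hmono s' s hs' hss) h)⟩
  have h1 := hB _ _ hfam fun _ s hs => hWi s hs
  have h2 : x₀ ∈ interior (closure {x | ∃ _ s : R, 0 < s ∧ x ∈ C \ interior (Z s)}) := by
    refine interior_maximal ?_ (isOpen_near δ x₀) (near_self hδ x₀)
    intro y hy
    refine subset_closure ?_
    have hyC : y ∈ C := fun i => (hy i).le
    obtain ⟨t, ht, hyt⟩ := hVZ y (hC hyC)
    exact ⟨0, t, ht, hyC, fun h => hyt (interior_subset h)⟩
  rw [h1] at h2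
  exact h2

end

section

variable {L : FirstOrder.Language.{u, v}} {R : Type w} [L.Structure R] [AddCommGroup R]
  [LinearOrder R] [IsOrderedAddMonoid R] [DefinableOAG L R] [DenselyOrdered R] [Nontrivial R]
  [TopologicalSpace R] [OrderTopology R] {Γ : Type w} [Ctx R Γ] {n : ℕ}
  {A : Set (Fin (n + 1) → R)} {F : R → R → Set (Fin (n + 1) → R)}

@[fun_prop]
theorem DMap.snoc {f : Γ → Fin n → R} {g : Γ → R} (hf : DMap L R f) (hg : DMap L R g) :
    DMap L R fun x => (Fin.snoc (f x) (g x) : Fin (n + 1) → R) := by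
  refine DMap.pi fun i => ?_
  induction i using Fin.lastCases with
  | last => simpa using hg
  | cast i => simpa using (by fun_prop : DMap L R fun x => f x i)

theorem snoc_castSucc_last (v : Fin (n + 1) → R) :
    (Fin.snoc (fun i : Fin n => v i.castSucc) (v (Fin.last n)) : Fin (n + 1) → R) = v := by
  ext i
  induction i using Fin.lastCases <;> simp

theorem continuous_snoc {X : Type*} [TopologicalSpace X] {f : X → Fin n → R} {g : X → R}
    (hf : Continuous f) (hg : Continuous g) :
    Continuous fun x => (Fin.snoc (f x) (g x) : Fin (n + 1) → R) := by
  refine continuous_pi fun i => ?_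
  induction i using Fin.lastCases with
  | last => simpa using hg
  | cast i => simpa using (by fun_prop : Continuous fun x => f x i)

/-- The points `(x, c)` with `|c| ≤ r` and `{x} × [c, c + s] ⊆ S`. -/
def vertical (S : Set (Fin (n + 1) → R)) (r s : R) : Set (Fin (n + 1) → R) :=
  {v | |v (Fin.last n)| ≤ r ∧ ∀ h, 0 ≤ h → h ≤ s →
    (Fin.snoc (fun i : Fin n => v i.castSucc) (v (Fin.last n) + h) : Fin (n + 1) → R) ∈ S}

theorem vertical_subset {S : Set (Fin (n + 1) → R)} {r s : R} (hs : 0 < s) :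
    vertical S r s ⊆ S := fun v hv => by
  have := hv.2 0 le_rfl hs.le
  rwa [add_zero, snoc_castSucc_last] at this

theorem DFam.vertical (hF : DFam L A F) :
    DFam L {v | ∃ r s, 0 < s ∧ v ∈ vertical (F r s) r s} fun r s => vertical (F r s) r s := by
  refine ⟨?_, fun r s hs => ?_, fun r s hs => ?_, ?_, fun v => Iff.rfl⟩
  · exact Dfn.and (by fun_prop) (Dfn.all (Dfn.imp (by fun_prop) (Dfn.imp (by fun_prop)
      (hF.mem (by fun_prop) (by fun_prop) (by fun_prop)))))
  · refine IsClosed.inter (s₁ := {v : Fin (n + 1) → R | |v (Fin.last n)| ≤ r})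
      (s₂ := {v : Fin (n + 1) → R | ∀ h, 0 ≤ h → h ≤ s →
        (Fin.snoc (fun i : Fin n => v i.castSucc) (v (Fin.last n) + h) : Fin (n + 1) → R) ∈ F r s})
      (isClosed_le (by fun_prop) continuous_const) ?_
    simp only [ofPred_forall]
    refine isClosed_iInter fun h => isClosed_iInter fun _ => isClosed_iInter fun _ => ?_
    exact (hF.isClosed r s hs).preimage (continuous_snoc (by fun_prop) (by fun_prop))
  · obtain ⟨M, hM⟩ := hF.bdd r s hs
    exact ⟨M, fun v hv => hM v (vertical_subset hs hv)⟩
  · intro r r' s s' hs' hss hr v hv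
    exact ⟨hv.1.trans hr, fun h h0 hh => hF.mono _ _ _ _ hs' hss hr (hv.2 h h0 (hh.trans hss))⟩

/-- Segments of length `s` over an open set, with starting points localized to within a small
fraction of `s`, share a common subinterval. Their union then contains an open box, which `F r s`
cannot. -/
theorem interior_proj_vertical (hDC : DC L R) (hF : DFam L A F) {r s : R} (hs : 0 < s)
    (hi : interior (F r s) = ∅) :
    interior (proj Fin.castSucc (vertical (F r s) r s)) = ∅ := by
  by_contra hne
  have hne := nonempty_iff_ne_empty.2 hne
  obtain ⟨s', hs', hss⟩ := exists_add_self_le hs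
  -- Four times `t` is at most `s`, so a segment starting within `t` of `c` covers the interval from
  -- `c + t` to `c + 2t`.
  obtain ⟨t, ht, hts⟩ := exists_add_self_le hs'
  have hV := hF.vertical
  obtain ⟨M, hM⟩ := hV.bdd r s hs
  obtain ⟨c, x₀, hx₀⟩ := hDC.exists_localize_coord
    (hV.mem (by fun_prop) (by fun_prop) (by fun_prop)) (hV.isClosed r s hs) hM Fin.castSucc hne ht
    (Fin.last n)
  set V := interior (proj Fin.castSucc (vertical (F r s) r s ∩ {z | |z (Fin.last n) - c| ≤ t}))
    with hVdef
  set O : Set (Fin (n + 1) → R) := {v | (fun i : Fin n => v i.castSucc) ∈ V} ∩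
    {v | v (Fin.last n) ∈ Ioo (c + t) (c + t + t)}
  have hO : IsOpen O := (isOpen_interior.preimage (by fun_prop)).inter
    (isOpen_Ioo.preimage (by fun_prop))
  have hOF : O ⊆ F r s := by
    rintro v ⟨hv, hv1, hv2⟩
    obtain ⟨w, ⟨hw, hwc⟩, hwv⟩ := interior_subset hv
    have hwc' := abs_sub_le_iff.1 hwc
    have h1 := hw.2 (v (Fin.last n) - w (Fin.last n))
      (sub_nonneg.2 ((sub_le_iff_le_add'.1 hwc'.1).trans hv1.le)) ?_
    · rw [add_sub_cancel] at h1
      have h2 : (fun i : Fin n => w i.castSucc) = fun i => v i.castSucc := hwv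
      rwa [h2, snoc_castSucc_last] at h1
    · have h3 : v (Fin.last n) - w (Fin.last n) ≤ (t + t) + (t + t) := by
        have h4 : v (Fin.last n) - c ≤ t + t := by
          rw [sub_le_iff_le_add', ← add_assoc]; exact hv2.le
        have h5 := add_le_add h4 (hwc'.2.trans (le_add_of_nonneg_left ht.le))
        simpa using h5
      exact h3.trans ((add_le_add hts hts).trans hss)
  obtain ⟨y, hy⟩ := exists_between (lt_add_of_pos_right (c + t) ht)
  have : (Fin.snoc x₀ y : Fin (n + 1) → R) ∈ interior (F r s) :=
    interior_maximal hOF hO ⟨by simpa using hx₀, by simpa using hy⟩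
  rw [hi] at this
  exact this

/-- If no member contains a vertical segment over `x`, then all fibers over `x` of the members are
closed without interior. -/
theorem thin_fiber_of_notMem (hDC : DC L R) (hL : LUF₂ L R) (hF : DFam L A F) {x : Fin n → R}
    (hx : x ∉ proj Fin.castSucc {v | ∃ r s, 0 < s ∧ v ∈ vertical (F r s) r s}) :
    Thin (fiber A x) := by
  have h := thin_iUnion_family hDC hL (F := fun r s => {y | (Fin.snoc x y : Fin (n + 1) → R) ∈ F r s})
    (hF.mem (by fun_prop) (by fun_prop) (by fun_prop))
    (fun r s hs => (hF.isClosed r s hs).preimage (continuous_snoc continuous_const continuous_id))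
    (fun r s hs => ?_) (fun r r' s s' h1 h2 h3 y hy => hF.mono r r' s s' h1 h2 h3 hy)
  · exact h.mono fun y hy => (hF.mem_iff _).1 hy
  · by_contra hne
    obtain ⟨y, hy⟩ := nonempty_iff_ne_empty.2 hne
    obtain ⟨ε, hε, H⟩ := (nhds_basis_abs_sub_lt y).mem_iff.1 (mem_interior_iff_mem_nhds.1 hy)
    obtain ⟨δ, hδ, hδε⟩ := exists_between hε
    have hm : 0 < min s δ := lt_min hs hδ
    refine hx ⟨Fin.snoc x y, ⟨max r |y|, min s δ, hm, ?_, ?_⟩, by ext i; simp⟩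
    · simp
    · intro h h0 hh
      simp only [Fin.snoc_castSucc, Fin.snoc_last]
      refine hF.mono _ _ _ _ hm (min_le_left _ _) (le_max_left _ _) (H ?_)
      simp only [mem_ofPred_eq, add_sub_cancel_left, abs_of_nonneg h0]
      exact (hh.trans (min_le_right _ _)).trans_lt hδε

theorem Baire.exists_thin_fibers (hDC : DC L R) (hL : LUF₂ L R) (hB : Baire L R n)
    (hF : DFam L A F) (hi : ∀ r s, 0 < s → interior (F r s) = ∅) {V : Set (Fin n → R)}
    (hV : IsOpen V) (hne : V.Nonempty) :
    ∃ V' ⊆ V, IsOpen V' ∧ V'.Nonempty ∧ ∀ x ∈ V', Thin (fiber A x) := by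
  have h1 := hB _ _ (hF.vertical.proj hDC Fin.castSucc) fun r s hs =>
    interior_proj_vertical hDC hF hs (hi r s hs)
  refine ⟨V \ closure _, sdiff_subset, hV.sdiff isClosed_closure, ?_, fun x hx =>
    thin_fiber_of_notMem hDC hL hF fun h => hx.2 (subset_closure h)⟩
  by_contra hemp
  rw [not_nonempty_iff_eq_empty, sdiff_eq_empty] at hemp
  have h2 := interior_maximal hemp hV
  rw [h1] at h2
  exact hne.not_subset_empty h2

/-- If `A` were dense in a box, then by induction its fibers would be closed and discrete over an
open part of the base. Each such fiber misses a short interval just above the height `a`, and the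
length of this interval can be made uniform on a smaller open set, producing an open box free of
`A`. -/
theorem baire (hDC : DC L R) (hL : LUF₂ L R) (n : ℕ) : Baire L R n := by
  induction n with
  | zero =>
    intro A F hF hi
    have hA : A = ∅ := by
      rw [eq_empty_iff_forall_notMem]
      intro z hz
      obtain ⟨r, s, hs, hz⟩ := (hF.mem_iff z).1 hz
      have h1 : z ∈ interior (F r s) := by
        have : F r s = univ := by
          ext y
          simpa [Subsingleton.elim y z] using hz
        simp [this]
      rw [hi r s hs] at h1
      exact h1
    simp [hA]
  | succ n ih =>
    intro A F hF hi
    by_contra hne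
    obtain ⟨v, hv⟩ := nonempty_iff_ne_empty.2 hne
    obtain ⟨ε, hε, hO⟩ := (nhds_basis_near v).mem_iff.1 (mem_interior_iff_mem_nhds.1 hv)
    set a := v (Fin.last n)
    obtain ⟨V', hV's, hV'o, hV'n, hT⟩ := ih.exists_thin_fibers hDC hL hF hi
      (isOpen_near ε fun i : Fin n => v i.castSucc) ⟨_, near_self hε _⟩
    -- `Z t` is the set of base points whose fiber meets the interval of length `t` above `a`.
    let Z : R → Set (Fin n → R) := fun t =>
      proj Fin.castSucc (A ∩ {w | w (Fin.last n) ∈ Ioo a (a + t)})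
    have hA : DSig L A := ⟨F, hF⟩
    have hAd := hA.dfn
    have hZd : Dfn L R fun p : R × (Fin n → R) => p.2 ∈ Z p.1 := by
      have : Dfn L R fun p : R × (Fin n → R) => ∃ w : Fin (n + 1) → R,
          (w ∈ A ∧ a < w (Fin.last n) ∧ w (Fin.last n) < a + p.1) ∧
            (fun i : Fin n => w i.castSucc) = p.2 := by fun_prop
      exact this
    have hZ : ∀ t, 0 < t → DSig L (Z t) := by
      intro t _
      refine (hA.inter (DSig.of_isOpen ?_ (isOpen_Ioo.preimage (by fun_prop)))).proj hDC _
      have : Dfn L R fun w : Fin (n + 1) → R => a < w (Fin.last n) ∧ w (Fin.last n) < a + t := by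
        fun_prop
      exact this
    obtain ⟨t, ht, V'', hV''s, hV''o, ⟨x, hx⟩, hVZ⟩ := ih.exists_avoid hZd hZ
      (fun t t' _ htt => proj_mono _ fun w hw =>
        ⟨hw.1, hw.2.1, hw.2.2.trans_le (add_le_add_right htt a)⟩) hV'o hV'n fun x hx => by
        obtain ⟨t, ht, H⟩ := hT x hx a
        refine ⟨t, ht, ?_⟩
        rintro ⟨w, ⟨hwA, hw1, hw2⟩, rfl⟩
        refine hw1.ne' (H _ ?_ ?_)
        · simpa [fiber, snoc_castSucc_last] using hwA
        · rwa [abs_of_pos (sub_pos.2 hw1), sub_lt_iff_lt_add']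
    set O : Set (Fin (n + 1) → R) := {w | (fun i : Fin n => w i.castSucc) ∈ V''} ∩
      {w | w (Fin.last n) ∈ Ioo a (a + min t ε)} with hOdef
    have hOo : IsOpen O := (hV''o.preimage (by fun_prop)).inter (isOpen_Ioo.preimage (by fun_prop))
    obtain ⟨y, hy⟩ := exists_between (lt_add_of_pos_right a (lt_min ht hε))
    have hz : (Fin.snoc x y : Fin (n + 1) → R) ∈ O := ⟨by simpa using hx, by simpa using hy⟩
    have hcl : (Fin.snoc x y : Fin (n + 1) → R) ∈ closure A := by
      refine hO fun i => ?_
      induction i using Fin.lastCases with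
      | last =>
        rw [Fin.snoc_last, abs_of_pos (sub_pos.2 hy.1), sub_lt_iff_lt_add']
        exact hy.2.trans_le (add_le_add_right (min_le_right _ _) a)
      | cast i => simpa using hV's (hV''s hx) i
    obtain ⟨w, ⟨hw1, hw2⟩, hwA⟩ := mem_closure_iff.1 hcl O hOo hz
    exact hVZ _ hw1 ⟨w, ⟨hwA, hw2.1, hw2.2.trans_le (add_le_add_right (min_le_left _ _) a)⟩, rfl⟩

end

/-! ### Dimension and complements -/

section

variable {L : FirstOrder.Language.{u, v}} {R : Type w} [L.Structure R] [AddCommGroup R]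
  [LinearOrder R] [IsOrderedAddMonoid R] [DefinableOAG L R] [DenselyOrdered R] [Nontrivial R]
  [TopologicalSpace R] [OrderTopology R] {ι : Type} [Finite ι]
  {A : Set (ι → R)} {d : ℕ}

/-- The dimension of `A` is less than `d`: no projection to `d` coordinates has interior. -/
def DimLT (d : ℕ) (A : Set (ι → R)) : Prop := ∀ e : Fin d → ι, interior (proj e A) = ∅

theorem DimLT.eq_empty (h : DimLT 0 A) : A = ∅ := by
  rw [eq_empty_iff_forall_notMem]
  intro z hz
  have h1 : proj (Fin.elim0 : Fin 0 → ι) A = univ := by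
    ext y
    simp only [mem_univ, iff_true]
    exact ⟨z, hz, Subsingleton.elim _ _⟩
  have := h Fin.elim0
  rw [h1, interior_univ] at this
  exact (univ_nonempty (α := Fin 0 → R)).ne_empty this

/-- With too many coordinates one is repeated, and the image lies in a diagonal. -/
theorem dimLT_of_card_lt (h : Nat.card ι < d) (A : Set (ι → R)) : DimLT d A := by
  intro e
  rw [eq_empty_iff_forall_notMem]
  intro x hx
  have hninj : ¬ Function.Injective e := fun hinj => by
    have := Nat.card_le_card_of_injective e hinj
    simp at this
    omega
  simp only [Function.Injective, not_forall] at hninj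
  obtain ⟨a, b, hab, hne⟩ := hninj
  obtain ⟨ε, hε, H⟩ := mem_interior_iff_near.1 hx
  obtain ⟨δ, hδ, hδε⟩ := exists_between hε
  have hdiag : ∀ y ∈ proj e A, y a = y b := by
    rintro _ ⟨z, -, rfl⟩
    simp [hab]
  have h1 := hdiag x (interior_subset hx)
  have h2 := hdiag (Function.update x a (x a + δ)) (H _ fun i => by
    rcases eq_or_ne i a with rfl | hi
    · simpa [abs_of_pos hδ] using hδε
    · simpa [hi] using hε)
  rw [Function.update_self, Function.update_of_ne (Ne.symm hne), h1] at h2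
  exact hδ.ne' (by simpa using h2)

/-- The largest open set in which `A` is relatively closed. -/
def closedLocus (A : Set (ι → R)) : Set (ι → R) := interior (A ∪ (closure A)ᶜ)

theorem closure_inter_closedLocus : closure A ∩ closedLocus A ⊆ A := by
  rintro z ⟨hz, hzU⟩
  exact (interior_subset hzU).resolve_right fun h => h hz

theorem Dfn.closedLocus (hA : Dfn L R (· ∈ A)) : Dfn L R (· ∈ closedLocus A) :=
  Dfn.interior (hA.or hA.closure.not)

theorem exists_thin_coords (hDC : DC L R) (hL : LUF₂ L R) (hA : DSig L A)
    (hdim : DimLT (d + 1) A) (e : Fin d → ι) {V : Set (Fin d → R)} (hV : IsOpen V)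
    (hne : V.Nonempty) :
    ∃ V' ⊆ V, IsOpen V' ∧ V'.Nonempty ∧
      ∀ x ∈ V', ∀ j, Thin {y | ∃ z ∈ A, (fun i => z (e i)) = x ∧ z j = y} := by
  classical
  cases nonempty_fintype ι
  suffices h : ∀ J : Finset ι, ∃ V' ⊆ V, IsOpen V' ∧ V'.Nonempty ∧
      ∀ x ∈ V', ∀ j ∈ J, Thin {y | ∃ z ∈ A, (fun i => z (e i)) = x ∧ z j = y} by
    simpa using h Finset.univ
  intro J
  induction J using Finset.induction_on with
  | empty => exact ⟨V, Subset.rfl, hV, hne, by simp⟩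
  | insert j J hj ih =>
    obtain ⟨V₁, hV₁, ho₁, hne₁, H₁⟩ := ih
    obtain ⟨F, hF⟩ := hA
    -- Appending `j` to the `d` chosen coordinates gives a projection to `d + 1` coordinates, which
    -- has no interior by the dimension hypothesis.
    obtain ⟨V₂, hV₂, ho₂, hne₂, H₂⟩ := (baire hDC hL d).exists_thin_fibers hDC hL
      (hF.proj hDC (Fin.snoc e j : Fin (d + 1) → ι)) (fun r s hs => by
        rw [← subset_empty_iff, ← hdim (Fin.snoc e j)]
        exact interior_mono (proj_mono _ (hF.subset hs))) ho₁ hne₁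
    refine ⟨V₂, hV₂.trans hV₁, ho₂, hne₂, fun x hx i hi => ?_⟩
    rcases Finset.mem_insert.1 hi with rfl | hi
    · refine (H₂ x hx).mono ?_
      rintro y ⟨z, hz, rfl, rfl⟩
      refine ⟨z, hz, ?_⟩
      ext k
      induction k using Fin.lastCases <;> simp
    · exact H₁ x (hV₂ hx) i hi

/-- The points `x` over which there are points of `K` and of `A`, distinct and at distance at
most `t`. -/
def closePairs (e : Fin d → ι) (K A : Set (ι → R)) (t : R) : Set (Fin d → R) :=
  {x | ∃ z, (z ∈ K ∧ (fun i => z (e i)) = x) ∧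
    ∃ z', z' ∈ A ∧ z' ≠ z ∧ (∀ i, |z' i - z i| ≤ t) ∧ (fun i => z' (e i)) = x}

theorem dfn_closePairs (e : Fin d → ι) {K : Set (ι → R)} (hK : Dfn L R (· ∈ K))
    (hA : Dfn L R (· ∈ A)) :
    Dfn L R fun p : R × (Fin d → R) => p.2 ∈ closePairs e K A p.1 :=
  Dfn.ex (Dfn.and (by fun_prop) (Dfn.ex (Dfn.and (by fun_prop) (Dfn.and (by fun_prop)
    (Dfn.and (Dfn.all_finite fun i => by fun_prop) (by fun_prop))))))

/-- A projection from the doubled space of pairs: distinctness is an open condition, while closeness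
and equality of base points are closed. -/
theorem DSig.closePairs (hDC : DC L R) (e : Fin d → ι) {K : Set (ι → R)} (hK : DSig L K)
    (hA : DSig L A) (t : R) : DSig L (closePairs e K A t) := by
  have h1 : DSig L {w : ι ⊕ ι → R | (fun i => w (.inl i)) ∈ K} := hK.preimage Sum.inl
  have h2 : DSig L {w : ι ⊕ ι → R | (fun i => w (.inr i)) ∈ A} := hA.preimage Sum.inr
  have h3 : DSig L {w : ι ⊕ ι → R | (fun i => w (.inr i)) ≠ fun i => w (.inl i)} := by
    refine DSig.of_isOpen (Dfn.not (Dfn.eq (by fun_prop) (by fun_prop))) ?_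
    exact isOpen_ne_fun (by fun_prop) (by fun_prop)
  have h4 : DSig L {w : ι ⊕ ι → R | (∀ i, |w (.inr i) - w (.inl i)| ≤ t) ∧
      (fun i => w (.inr (e i))) = fun i => w (.inl (e i))} := by
    refine DSig.of_isClosed (Dfn.and (Dfn.all_finite fun i => by fun_prop)
      (Dfn.eq (by fun_prop) (by fun_prop))) ?_
    refine IsClosed.inter (s₁ := {w : ι ⊕ ι → R | ∀ i, |w (.inr i) - w (.inl i)| ≤ t})
      (s₂ := {w : ι ⊕ ι → R | (fun i => w (.inr (e i))) = fun i => w (.inl (e i))}) ?_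
      (isClosed_eq (by fun_prop) (by fun_prop))
    simp only [ofPred_forall]
    exact isClosed_iInter fun i => isClosed_le (by fun_prop) continuous_const
  convert (((h1.inter h2).inter h3).inter h4).proj hDC fun i => Sum.inl (e i) using 1
  ext x
  constructor
  · rintro ⟨z, ⟨hz, rfl⟩, z', hz', hne, ht, he⟩
    exact ⟨Sum.elim z z', ⟨⟨⟨hz, hz'⟩, hne⟩, ht, he⟩, rfl⟩
  · rintro ⟨w, ⟨⟨⟨hz, hz'⟩, hne⟩, ht, he⟩, rfl⟩
    exact ⟨_, ⟨hz, rfl⟩, _, hz', hne, ht, he⟩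

/-- Otherwise pairs at distance tending to `0` cluster at some `z₀`. Over `x` every coordinate takes
values isolated at that of `z₀`, so both points of a sufficiently close pair equal `z₀`. -/
theorem exists_notMem_closePairs (hDC : DC L R) (e : Fin d → ι) {K : Set (ι → R)}
    (hK : Dfn L R (· ∈ K)) (hA : Dfn L R (· ∈ A)) (hKA : K ⊆ A) {M : R}
    (hM : ∀ z ∈ K, ∀ i, |z i| ≤ M) {x : Fin d → R}
    (hT : ∀ j, Thin {y | ∃ z ∈ A, (fun i => z (e i)) = x ∧ z j = y}) :
    ∃ t, 0 < t ∧ x ∉ closePairs e K A t := by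
  by_contra! hcon
  obtain ⟨z₀, hz₀⟩ := hDC.exists_cluster (F := fun t => {z | (z ∈ K ∧ (fun i => z (e i)) = x) ∧
    ∃ z', z' ∈ A ∧ z' ≠ z ∧ (∀ i, |z' i - z i| ≤ t) ∧ (fun i => z' (e i)) = x})
    (Dfn.and (by fun_prop) (Dfn.ex (Dfn.and (by fun_prop) (Dfn.and (by fun_prop)
      (Dfn.and (Dfn.all_finite fun i => by fun_prop) (by fun_prop)))))) hcon
    (fun t t' _ htt z hz => ⟨hz.1, let ⟨z', h1, h2, h3, h4⟩ := hz.2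
      ⟨z', h1, h2, fun i => (h3 i).trans htt, h4⟩⟩) (M := M) (fun t _ z hz => hM z hz.1.1)
  have hev : ∀ᶠ ε in 𝓝[>] (0 : R), ∀ j,
      ∀ y, (∃ z ∈ A, (fun i => z (e i)) = x ∧ z j = y) → |y - z₀ j| < ε → y = z₀ j := by
    rw [eventually_all]
    intro j
    obtain ⟨ε, hε, H⟩ := hT j (z₀ j)
    filter_upwards [Ioo_mem_nhdsGT hε] with δ hδ y hy hya
    exact H y hy (hya.trans hδ.2)
  obtain ⟨ε, hε, hε0⟩ := (hev.and self_mem_nhdsWithin).exists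
  obtain ⟨t, ht, htε⟩ := exists_add_self_le (show 0 < ε from hε0)
  obtain ⟨z, ⟨⟨hzK, hzx⟩, z', hz', hne, hzz, hzx'⟩, hnear⟩ := hz₀ t ht
  have h1 : z = z₀ := funext fun j => hε j _ ⟨z, hKA hzK, hzx, rfl⟩
    ((hnear j).trans_le ((le_add_of_nonneg_left ht.le).trans htε))
  have h2 : z' = z₀ := funext fun j => hε j _ ⟨z', hz', hzx', rfl⟩ (by
    have := (abs_add_le (z' j - z j) (z j - z₀ j)).trans_lt (add_lt_add_of_le_of_lt (hzz j) (hnear j))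
    rw [sub_add_sub_cancel] at this
    exact this.trans_le htε)
  exact hne (h2.trans h1.symm)

/-- If the remainder had large dimension, a closed bounded piece `K` of it would project onto an
open set. Over a smaller open set the points of `A` keep a uniform distance `t` from distinct points
of `K` in the same fiber. Near a suitable point of `K` this forces `A` into `K`, so `A` is
relatively closed there, contrary to the choice of `K`. -/
theorem DimLT.sdiff_closedLocus (hDC : DC L R) (hL : LUF₂ L R) (hA : DSig L A)
    (hdim : DimLT (d + 1) A) : DimLT d (A \ closedLocus A) := by
  intro e
  by_contra hne
  have hD : DSig L (A \ closedLocus A) :=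
    hA.inter (DSig.of_isClosed hA.dfn.closedLocus.not isOpen_interior.isClosed_compl)
  obtain ⟨G, hG⟩ := hD
  have hrs : ∃ r s, 0 < s ∧ interior (proj e (G r s)) ≠ ∅ := by
    by_contra! hcon
    have h1 := baire hDC hL d _ _ (hG.proj hDC e) hcon
    have h2 := interior_mono (subset_closure (s := proj e (A \ closedLocus A)))
    rw [h1, subset_empty_iff] at h2
    exact hne h2
  obtain ⟨r, s, hs, hKi⟩ := hrs
  have hKc := hG.isClosed r s hs
  have hKd : Dfn L R (· ∈ G r s) := hG.mem (by fun_prop) (by fun_prop) (by fun_prop)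
  have hKs : G r s ⊆ A \ closedLocus A := hG.subset hs
  obtain ⟨M, hM⟩ := hG.bdd r s hs
  set K := G r s
  obtain ⟨V₁, hV₁, ho₁, hne₁, hT⟩ := exists_thin_coords hDC hL hA hdim e isOpen_interior
    (nonempty_iff_ne_empty.2 hKi)
  have hKA : K ⊆ A := hKs.trans sdiff_subset
  obtain ⟨t, ht, V₂, hV₂, ho₂, ⟨x₂, hx₂⟩, hZ⟩ := (baire hDC hL d).exists_avoid
    (dfn_closePairs e hKd hA.dfn)
    (fun t _ => DSig.closePairs hDC e (DSig.of_isClosed hKd hKc) hA t)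
    (fun t t' _ htt x hx => let ⟨z, hz, z', h1, h2, h3, h4⟩ := hx
      ⟨z, hz, z', h1, h2, fun i => (h3 i).trans htt, h4⟩) ho₁ hne₁
    fun x hx => exists_notMem_closePairs hDC e hKd hA.dfn hKA hM (hT x hx)
  obtain ⟨δ, hδ, hC⟩ := exists_cube_subset ho₂ hx₂
  set C : Set (Fin d → R) := {y | ∀ i, |y i - x₂ i| ≤ δ} with hCdef
  have hCd : Dfn L R (· ∈ C) := dfn_cube x₂ δ
  have hK₂d : Dfn L R (· ∈ K ∩ {z | (fun i => z (e i)) ∈ C}) := by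
    have : Dfn L R fun z : ι → R => z ∈ K ∧ (fun i => z (e i)) ∈ C := by fun_prop
    exact this
  have hK₂i : (interior (proj e (K ∩ {z | (fun i => z (e i)) ∈ C}))).Nonempty := by
    refine ⟨x₂, interior_maximal ?_ (isOpen_near δ x₂) (near_self hδ x₂)⟩
    intro x hx
    have hxC : x ∈ C := fun i => (hx i).le
    obtain ⟨z, hz, rfl⟩ := interior_subset (hV₁ (hV₂ (hC hxC)))
    exact ⟨z, ⟨hz, hxC⟩, rfl⟩
  -- The budget is `t₁ + t₂ + t₂ ≤ t`: from a point of `A` to `z₀`, from `z₀` to the centre `c`, and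
  -- from `c` to the point of `K` in the same fiber.
  obtain ⟨t₁, ht₁, htt₁⟩ := exists_add_self_le ht
  obtain ⟨t₂, ht₂, htt₂⟩ := exists_add_self_le ht₁
  obtain ⟨c, x₃, hx₃⟩ := hDC.exists_localize hK₂d
    (hKc.inter ((isClosed_cube x₂ δ).preimage (by fun_prop))) (fun z hz => hM z hz.1) e hK₂i ht₂
  set V₃ := interior (proj e ((K ∩ {z | (fun i => z (e i)) ∈ C}) ∩ {z | ∀ i, |z i - c i| ≤ t₂}))
    with hV₃
  obtain ⟨z₀, ⟨⟨hz₀K, -⟩, hz₀c⟩, hz₀x⟩ := interior_subset hx₃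
  set O : Set (ι → R) := {z | (fun i => z (e i)) ∈ V₃} ∩ {z | Near t₁ z₀ z} with hO
  have hOo : IsOpen O := (isOpen_interior.preimage (by fun_prop)).inter (isOpen_near t₁ z₀)
  have hOA : O ∩ A ⊆ K := by
    rintro z' ⟨⟨hz'V, hz'n⟩, hz'A⟩
    obtain ⟨z, ⟨⟨hzK, hzC⟩, hzc⟩, hzz'⟩ := interior_subset hz'V
    have hzz'' : (fun i => z (e i)) = fun i => z' (e i) := hzz'
    by_contra hz'K
    refine hZ _ (hC hzC) ⟨z, ⟨hzK, rfl⟩, z', hz'A, fun h => hz'K (h ▸ hzK), fun i => ?_,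
      hzz''.symm⟩
    have h1 : |c i - z i| ≤ t₂ := by rw [abs_sub_comm]; exact hzc i
    have h2 := (abs_add_three (z' i - z₀ i) (z₀ i - c i) (c i - z i)).trans
      (add_le_add (add_le_add (hz'n i).le (hz₀c i)) h1)
    rw [sub_add_sub_cancel, sub_add_sub_cancel, add_assoc] at h2
    exact h2.trans ((add_le_add_right htt₂ t₁).trans htt₁)
  have hz₀O : z₀ ∈ O := ⟨by
    change (fun i => z₀ (e i)) ∈ V₃
    rw [show (fun i => z₀ (e i)) = x₃ from hz₀x]
    exact hx₃, near_self ht₁ z₀⟩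
  refine (hKs hz₀K).2 (interior_maximal ?_ hOo hz₀O)
  intro z hz
  by_cases hzc : z ∈ closure A
  · exact Or.inl (hKA (hKc.closure_subset (closure_mono hOA (hOo.inter_closure ⟨hz, hzc⟩))))
  · exact Or.inr hzc

theorem DSig.compl_of_dimLT (hDC : DC L R) (hL : LUF₂ L R) (hA : DSig L A) (hdim : DimLT d A) :
    DSig L Aᶜ := by
  induction d generalizing A with
  | zero =>
    rw [hdim.eq_empty, compl_empty]
    exact DSig.of_isClosed (Dfn.const True) isClosed_univ
  | succ d ih =>
    have hUd := hA.dfn.closedLocus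
    have hUo : IsOpen (closedLocus A) := isOpen_interior
    have h1 : DSig L (A \ closedLocus A)ᶜ :=
      ih (hA.inter (DSig.of_isClosed hUd.not hUo.isClosed_compl))
        (hdim.sdiff_closedLocus hDC hL hA)
    have h2 : DSig L ((closure A)ᶜ ∪ (closedLocus A)ᶜ) :=
      (DSig.of_isOpen hA.dfn.closure.not isClosed_closure.isOpen_compl).union
        (DSig.of_isClosed hUd.not hUo.isClosed_compl)
    convert h1.inter h2 using 1
    ext z
    have h3 : z ∈ A → z ∈ closure A := fun h => subset_closure h
    have h4 : z ∈ closure A → z ∈ closedLocus A → z ∈ A :=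
      fun h h' => closure_inter_closedLocus ⟨h, h'⟩
    simp only [mem_compl_iff, mem_inter_iff, mem_union, Set.mem_sdiff]
    tauto

theorem DSig.compl (hDC : DC L R) (hL : LUF₂ L R) (hA : DSig L A) : DSig L Aᶜ :=
  hA.compl_of_dimLT hDC hL (dimLT_of_card_lt (Nat.lt_succ_self _) A)

/-- The frontier of a `DSig` set has empty interior. -/
theorem DSig.interior_frontier (hDC : DC L R) (hL : LUF₂ L R) {n : ℕ} {A : Set (Fin n → R)}
    (hA : DSig L A) : interior (frontier A) = ∅ := by
  set O := interior (frontier A) with hO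
  have hOd : Dfn L R (· ∈ O) := by
    refine Dfn.interior ?_
    exact hA.dfn.closure.and hA.dfn.interior.not
  have hOs : O ⊆ frontier A := interior_subset
  obtain ⟨F, hF⟩ := hA.inter (DSig.of_isOpen hOd isOpen_interior)
  have h1 := baire hDC hL n _ F hF fun r s hs => by
    rw [eq_empty_iff_forall_notMem]
    intro x hx
    exact (hOs (hF.subset hs (interior_subset hx)).2).2
      (interior_mono ((hF.subset hs).trans inter_subset_left) hx)
  have h2 : O ⊆ interior (closure (A ∩ O)) := by
    refine interior_maximal (fun x hx => ?_) isOpen_interior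
    rw [inter_comm]
    exact isOpen_interior.inter_closure ⟨hx, (hOs hx).1⟩
  rwa [h1, subset_empty_iff] at h2

end

theorem IsFiniteUnionPointsIntervals.union {R : Type w} [LinearOrder R] {S T : Set R}
    (hS : IsFiniteUnionPointsIntervals S) (hT : IsFiniteUnionPointsIntervals T) :
    IsFiniteUnionPointsIntervals (S ∪ T) := by
  obtain ⟨F, P, hF, hP, rfl⟩ := hS
  obtain ⟨F', P', hF', hP', rfl⟩ := hT
  refine ⟨F ∪ F', P ∪ P', hF.union hF', hP.union hP', ?_⟩
  rw [biUnion_union, union_union_union_comm]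

theorem isFiniteUnionPointsIntervals_of_finite {R : Type w} [LinearOrder R] {S : Set R}
    (hS : S.Finite) : IsFiniteUnionPointsIntervals S := ⟨S, ∅, hS, finite_empty, by simp⟩

theorem isFiniteUnionPointsIntervals_Ioo {R : Type w} [LinearOrder R] (a b : R) :
    IsFiniteUnionPointsIntervals (Ioo a b) :=
  ⟨∅, {(a, b)}, finite_empty, finite_singleton _, by simp⟩

section

variable {L : FirstOrder.Language.{u, v}} {R : Type w} [L.Structure R] [AddCommGroup R]
  [LinearOrder R] [IsOrderedAddMonoid R] [DefinableOAG L R] [DenselyOrdered R] [Nontrivial R]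
  [TopologicalSpace R] [OrderTopology R]

theorem mem_of_disjoint_frontier (hDC : DC L R) {S : Set R} (hd : Dfn L R (· ∈ S)) {y z : R}
    (hyz : y ≤ z) (hf : ∀ x ∈ Icc y z, x ∉ frontier S) (hy : y ∈ S) : z ∈ S := by
  have hd' : Dfn L R (· ∈ S ∩ Icc y z) := by
    have : Dfn L R fun x => x ∈ S ∧ y ≤ x ∧ x ≤ z := by fun_prop
    exact this
  have hne : (S ∩ Icc y z).Nonempty := ⟨y, hy, le_rfl, hyz⟩
  obtain ⟨m, hm⟩ := hDC.exists_isLUB hd' hne ⟨z, fun x hx => hx.2.2⟩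
  have hym : y ≤ m := hm.1 ⟨hy, le_rfl, hyz⟩
  have hmz : m ≤ z := hm.2 fun x hx => hx.2.2
  have hmi : m ∈ interior S := by
    by_contra h
    exact hf m ⟨hym, hmz⟩ ⟨closure_mono inter_subset_left (hm.mem_closure hne), h⟩
  rcases hmz.lt_or_eq with h | rfl
  · obtain ⟨l, u, hlu, hS⟩ := mem_nhds_iff_exists_Ioo_subset.1 (mem_interior_iff_mem_nhds.1 hmi)
    obtain ⟨x, hmx, hx⟩ := exists_between (lt_min h hlu.2)
    rw [lt_min_iff] at hx
    exact absurd (hm.1 ⟨hS ⟨hlu.1.trans hmx, hx.2⟩, hym.trans hmx.le, hx.1.le⟩) hmx.not_ge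
  · exact interior_subset hmi

theorem isFiniteUnionPointsIntervals_inter_Ioo (hDC : DC L R) {S : Set R}
    (hd : Dfn L R (· ∈ S)) {c d : R} (hfin : (frontier S ∩ Ioo c d).Finite) :
    IsFiniteUnionPointsIntervals (S ∩ Ioo c d) := by
  induction hk : (frontier S ∩ Ioo c d).ncard using Nat.strong_induction_on generalizing c d with
  | _ k ih =>
    rcases (frontier S ∩ Ioo c d).eq_empty_or_nonempty with hemp | ⟨f, hf⟩
    · have hnf : ∀ {y z}, y ∈ Ioo c d → z ∈ Ioo c d → ∀ x ∈ Icc y z, x ∉ frontier S :=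
        fun hy hz x hx hxf => hemp.subset ⟨hxf, hy.1.trans_le hx.1, hx.2.trans_lt hz.2⟩
      by_cases hS : ∃ y ∈ Ioo c d, y ∈ S
      · obtain ⟨y, hy, hyS⟩ := hS
        rw [inter_eq_right.2]
        · exact isFiniteUnionPointsIntervals_Ioo c d
        · intro z hz
          rcases le_total y z with h | h
          · exact mem_of_disjoint_frontier hDC hd h (hnf hy hz) hyS
          · by_contra hzS
            refine mem_of_disjoint_frontier (S := Sᶜ) hDC hd.not h ?_ hzS hyS
            rw [frontier_compl]
            exact hnf hz hy
      · have : S ∩ Ioo c d = ∅ := by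
          rw [eq_empty_iff_forall_notMem]
          exact fun y hy => hS ⟨y, hy.2, hy.1⟩
        rw [this]
        exact isFiniteUnionPointsIntervals_of_finite finite_empty
    · have h1 : frontier S ∩ Ioo c f ⊂ frontier S ∩ Ioo c d :=
        ⟨fun x hx => ⟨hx.1, hx.2.1, hx.2.2.trans hf.2.2⟩, fun h => (h hf).2.2.false⟩
      have h2 : frontier S ∩ Ioo f d ⊂ frontier S ∩ Ioo c d :=
        ⟨fun x hx => ⟨hx.1, hf.2.1.trans hx.2.1, hx.2.2⟩, fun h => (h hf).2.1.false⟩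
      have h3 := (ih _ (hk ▸ ncard_lt_ncard h1 hfin) (hfin.subset h1.1) rfl).union
        (ih _ (hk ▸ ncard_lt_ncard h2 hfin) (hfin.subset h2.1) rfl)
      have h4 := h3.union (isFiniteUnionPointsIntervals_of_finite
        ((finite_singleton f).subset (inter_subset_right (s := S))))
      convert h4 using 1
      rw [← inter_union_distrib_left, ← inter_union_distrib_left]
      congr 1
      ext x
      simp only [mem_Ioo, mem_union, mem_singleton_iff]
      constructor
      · intro hx
        rcases lt_trichotomy x f with h | h | h
        · exact Or.inl (Or.inl ⟨hx.1, h⟩)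
        · exact Or.inr h
        · exact Or.inl (Or.inr ⟨h, hx.2⟩)
      · rintro ((hx | hx) | rfl)
        · exact ⟨hx.1, hx.2.trans hf.2.2⟩
        · exact ⟨hf.2.1.trans hx.1, hx.2⟩
        · exact hf.2

theorem mem_frontier_iff_abs {S : Set R} {y : R} :
    y ∈ frontier S ↔ (∀ ε, 0 < ε → ∃ z, z ∈ S ∧ |z - y| < ε) ∧
      ¬ ∃ ε, 0 < ε ∧ ∀ z, |z - y| < ε → z ∈ S := by
  rw [frontier, Set.mem_sdiff, mem_closure_iff_nhds_basis (nhds_basis_abs_sub_lt y),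
    mem_interior_iff_mem_nhds, (nhds_basis_abs_sub_lt y).mem_iff]
  rfl

theorem dfn_frontier_fiber {m : ℕ} {X : Set (Fin (m + 1) → R)} (hX : Dfn L R (· ∈ X)) :
    Dfn L R fun p : (Fin m → R) × R => p.2 ∈ frontier (fiber X p.1) := by
  have : Dfn L R fun p : (Fin m → R) × R =>
      (∀ ε : R, 0 < ε → ∃ z : R, (Fin.snoc p.1 z : Fin (m + 1) → R) ∈ X ∧ |z - p.2| < ε) ∧
      ¬ ∃ ε : R, 0 < ε ∧ ∀ z : R, |z - p.2| < ε → (Fin.snoc p.1 z : Fin (m + 1) → R) ∈ X := by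
    fun_prop
  exact this.congr fun p => mem_frontier_iff_abs

theorem DSig.thin_frontier_fiber (hDC : DC L R) (hL : LUF₂ L R) {m : ℕ}
    {X : Set (Fin (m + 1) → R)} (hX : DSig L X) (x : Fin m → R) :
    Thin (frontier (fiber X x)) := by
  have h1 : DSig L {v : Fin 1 → R | v 0 ∈ fiber X x} := by
    have h2 : DSig L {w : Fin (m + 1) → R | (fun i : Fin m => w i.castSucc) = x} :=
      DSig.of_isClosed (Dfn.eq (by fun_prop) (by fun_prop))
        (isClosed_eq (by fun_prop) continuous_const)
    convert (hX.inter h2).proj hDC (fun _ : Fin 1 => Fin.last m) using 1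
    ext v
    constructor
    · intro hv
      refine ⟨Fin.snoc x (v 0), ⟨hv, ?_⟩, ?_⟩
      · ext i
        simp
      · ext i
        simp [Subsingleton.elim i 0]
    · rintro ⟨w, ⟨hw, rfl⟩, rfl⟩
      simpa [fiber, snoc_castSucc_last] using hw
  have h3 := h1.interior_frontier hDC hL
  let h := Homeomorph.funUnique (Fin 1) R
  have h4 : {v : Fin 1 → R | v 0 ∈ fiber X x} = h ⁻¹' (fiber X x) := rfl
  rw [h4, ← h.preimage_frontier, ← h.preimage_interior] at h3
  refine thin_of_isClosed hDC hL ((dfn_frontier_fiber hX.dfn).comp_map (f := fun y => (x, y))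
    (by fun_prop)) isClosed_frontier ?_
  rwa [preimage_eq_empty_iff, h.surjective.range_eq, disjoint_univ] at h3

theorem continuous_dmap_realize {α : Type} [Finite α]
    (t : (openCore L R)[[(univ : Set R)]].Term α) :
    Continuous (fun w : α → R => t.realize w) ∧ DMap L R fun w : α → R => t.realize w := by
  induction t with
  | var i => exact ⟨by simpa using continuous_apply i, by simpa using DMap.apply' i⟩
  | @func n f ts _ =>
    cases n with
    | zero =>
      have : (fun w : α → R => (FirstOrder.Language.Term.func f ts).realize w) = fun _ =>
          (FirstOrder.Language.Term.func f ts).realize (0 : α → R) := by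
        funext w
        simp only [FirstOrder.Language.Term.realize]
        congr 1
        exact Subsingleton.elim _ _
      rw [this]
      exact ⟨continuous_const, DMap.const _⟩
    | succ n =>
      rcases f with f | f
      · exact f.elim
      · exact isEmptyElim f

theorem DSig.realize (hDC : DC L R) (hL : LUF₂ L R) {α : Type} [Finite α] {n : ℕ}
    (φ : (openCore L R)[[(univ : Set R)]].BoundedFormula α n) :
    DSig L {w : α ⊕ Fin n → R | φ.Realize (fun i => w (.inl i)) fun i => w (.inr i)} := by
  have helim : ∀ {n : ℕ} (w : α ⊕ Fin n → R),
      Sum.elim (fun i => w (.inl i)) (fun i => w (.inr i)) = w := fun w => by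
    ext (i | i) <;> rfl
  induction φ with
  | falsum => exact DSig.of_isClosed (Dfn.const False) isClosed_empty
  | equal t₁ t₂ =>
    simp only [FirstOrder.Language.BoundedFormula.Realize, helim]
    obtain ⟨h1, h2⟩ := continuous_dmap_realize t₁
    obtain ⟨h3, h4⟩ := continuous_dmap_realize t₂
    exact DSig.of_isClosed (Dfn.eq h2 h4) (isClosed_eq h1 h3)
  | rel r ts =>
    simp only [FirstOrder.Language.BoundedFormula.Realize, helim]
    rcases r with U | r
    · have hU : Dfn L R (· ∈ U.1) := U.2.2
      have h1 := fun i => (continuous_dmap_realize (L := L) (ts i)).1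
      have h2 := fun i => (continuous_dmap_realize (L := L) (ts i)).2
      exact DSig.of_isOpen (hU.comp_map (DMap.pi h2)) (U.2.1.preimage (continuous_pi h1))
    · exact isEmptyElim r
  | imp φ ψ ih₁ ih₂ =>
    simp only [FirstOrder.Language.BoundedFormula.realize_imp, imp_iff_not_or]
    exact (ih₁.compl hDC hL).union ih₂
  | @all n φ ih =>
    have h1 := ((ih.compl hDC hL).proj hDC (Sum.map id Fin.castSucc : α ⊕ Fin n → _)).compl hDC hL
    convert h1 using 1
    ext w
    simp only [FirstOrder.Language.BoundedFormula.realize_all, mem_ofPred_eq, mem_compl_iff]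
    constructor
    · rintro h ⟨v, hv, rfl⟩
      refine hv ?_
      have := h (v (.inr (Fin.last n)))
      change φ.Realize (fun i => v (.inl i))
        (Fin.snoc (fun i : Fin n => v (.inr i.castSucc)) (v (.inr (Fin.last n)))) at this
      rwa [snoc_castSucc_last fun i => v (.inr i)] at this
    · intro h a
      by_contra ha
      refine h ⟨Sum.elim (fun i => w (.inl i)) (Fin.snoc (fun i => w (.inr i)) a), ha, ?_⟩
      ext (i | i) <;> simp

theorem DSig.of_definable_openCore (hDC : DC L R) (hL : LUF₂ L R) {α : Type} [Finite α]
    {X : Set (α → R)} (hX : (univ : Set R).Definable (openCore L R) X) : DSig L X := by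
  obtain ⟨φ, rfl⟩ := hX
  convert (DSig.realize hDC hL φ).proj hDC (Sum.inl : α → α ⊕ Fin 0) using 1
  ext v
  constructor
  · intro hv
    refine ⟨Sum.elim v Fin.elim0, ?_, rfl⟩
    change FirstOrder.Language.BoundedFormula.Realize φ v _
    rwa [Subsingleton.elim (fun i => _) default]
  · rintro ⟨w, hw, rfl⟩
    change FirstOrder.Language.BoundedFormula.Realize φ (fun i => w (.inl i)) default
    rwa [Subsingleton.elim default fun i => w (.inr i)]

theorem LUF₁.luf₂ (h : LUF₁ L R) : LUF₂ L R := by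
  intro m X hX a b
  obtain ⟨N, hN, c, d, ha, H⟩ := h m X hX a
  choose p hp using fun i => exists_lt (b i)
  choose q hq using fun i => exists_gt (b i)
  exact ⟨N, hN, c, d, ha, p, q, fun i _ => ⟨hp i, hq i⟩, fun x _ => H x⟩

theorem SLUF.luf₁ (h : SLUF L R) : LUF₁ L R := by
  intro m X hX a
  obtain ⟨c, d, ha, H⟩ := h m a
  obtain ⟨N, hN, H⟩ := H X hX
  exact ⟨N, hN, c, d, ha, H⟩

theorem DSig.isFiniteUnionPointsIntervals_fiber (hDC : DC L R) (hL : LUF₂ L R) {m : ℕ}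
    {X : Set (Fin (m + 1) → R)} (hX : DSig L X) (x : Fin m → R) {a c d : R} {N : ℕ}
    (ha : a ∈ Ioo c d) (hB : FinitenessBound (frontier (fiber X x)) (Icc c d) a N) :
    IsFiniteUnionPointsIntervals (fiber X x ∩ Ioo c d) := by
  have hXd := hX.dfn
  refine isFiniteUnionPointsIntervals_inter_Ioo hDC ?_
    ((hX.thin_frontier_fiber hDC hL x).finite_of_finitenessBound hDC ?_ ha hB).1
  · have : Dfn L R fun y : R => (Fin.snoc x y : Fin (m + 1) → R) ∈ X := by fun_prop
    exact this
  · exact (dfn_frontier_fiber hXd).comp_map (f := fun y => (x, y)) (by fun_prop)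

theorem SLUF.stronglyLocallyOMinimal (hDC : DC L R) (h : SLUF L R) :
    StronglyLocallyOMinimal (openCore L R) R := by
  intro a
  have hL := h.luf₁.luf₂
  obtain ⟨c, d, ha, H⟩ := h 0 a
  rw [interior_Icc] at ha
  refine ⟨c, d, ha, fun X hX => ?_⟩
  have hXD : DSig L {v : Fin 1 → R | v 0 ∈ X} := DSig.of_definable_openCore hDC hL hX
  have hfib : fiber {v : Fin 1 → R | v 0 ∈ X} (0 : Fin 0 → R) = X := by
    ext y
    simp [fiber]
  obtain ⟨Y, hY, hYX⟩ := (dfn_frontier_fiber hXD.dfn).exists_fiber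
    (P := fun x y => y ∈ frontier (fiber {v : Fin 1 → R | v 0 ∈ X} x))
  obtain ⟨N, -, HN⟩ := H Y hY
  have := hXD.isFiniteUnionPointsIntervals_fiber hDC hL (0 : Fin 0 → R) ha (N := N)
    (by simpa [hYX] using HN 0)
  rwa [hfib] at this

theorem LUF₁.uniformlyLocallyOMinimal₁ (hDC : DC L R) (h : LUF₁ L R) :
    UniformlyLocallyOMinimal₁ (openCore L R) R := by
  intro m X hX a
  have hXD : DSig L X := DSig.of_definable_openCore hDC h.luf₂ hX
  obtain ⟨Y, hY, hYX⟩ := (dfn_frontier_fiber hXD.dfn).exists_fiber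
    (P := fun x y => y ∈ frontier (fiber X x))
  obtain ⟨N, -, c, d, ha, HN⟩ := h m Y hY a
  rw [interior_Icc] at ha
  exact ⟨c, d, ha, fun x => hXD.isFiniteUnionPointsIntervals_fiber hDC h.luf₂ x ha (N := N)
    (by simpa [hYX] using HN x)⟩

theorem LUF₂.uniformlyLocallyOMinimal₂ (hDC : DC L R) (h : LUF₂ L R) :
    UniformlyLocallyOMinimal₂ (openCore L R) R := by
  intro m X hX a b
  have hXD : DSig L X := DSig.of_definable_openCore hDC h hX
  obtain ⟨Y, hY, hYX⟩ := (dfn_frontier_fiber hXD.dfn).exists_fiber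
    (P := fun x y => y ∈ frontier (fiber X x))
  obtain ⟨N, -, c, d, ha, p, q, hb, HN⟩ := h m Y hY a b
  rw [interior_Icc] at ha
  exact ⟨c, d, ha, p, q, hb, fun x hx =>
    hXD.isFiniteUnionPointsIntervals_fiber hDC h x ha (N := N) (by simpa [hYX] using HN x hx)⟩

end

end LocOMin

theorem theorem1p1 {L : FirstOrder.Language} {R : Type*}
    [AddCommGroup R] [LinearOrder R] [IsOrderedAddMonoid R] [DenselyOrdered R] [Nontrivial R]
    [TopologicalSpace R] [OrderTopology R] [L.Structure R]
    (φ : LocOMin.oagLanguage.LHom L) [φ.IsExpansionOn R]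
    (hDC : LocOMin.DC L R) :
    (LocOMin.SLUF L R → LocOMin.StronglyLocallyOMinimal (LocOMin.openCore L R) R) ∧
    (LocOMin.LUF₁ L R → LocOMin.UniformlyLocallyOMinimal₁ (LocOMin.openCore L R) R) ∧
    (LocOMin.LUF₂ L R → LocOMin.UniformlyLocallyOMinimal₂ (LocOMin.openCore L R) R) := by
  have := LocOMin.DefinableOAG.of_expansion (R := R) φ
  exact ⟨fun h => h.stronglyLocallyOMinimal hDC, fun h => h.uniformlyLocallyOMinimal₁ hDC,
    fun h => h.uniformlyLocallyOMinimal₂ hDC⟩
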